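/- Let $f:[0,1]\to[0,1]$ be measurable and preserve a Borel probability measure $\mu$ that is absolutely continuous with respect to Lebesgue measure. Suppose that, for some Banach space $\mathcal C\subset L^1(\mu)$ of real-valued measurable functions, there is summable decay of correlations for observables in $\mathcal C$ against $L^1(\mu)$: there are $\rho_n>0$ ($n\ge1$) with $\sum_{n\ge 1}\rho_n<\infty$ such that for all $\phi\in\mathcal C$, $\psi\in L^1(\mu)$ and $n\ge1$ the function $\phi\cdot(\psi\circ f^n)$ is integrable and $$\Big|\int \phi\,(\psi\circ f^n)\,d\mu-\int\phi\,d\mu\int\psi\,d\mu\Big|\le\rho_n\|\phi\|_{\mathcal C}\|\psi\|_{L^1(\mu)} .$$ Let $\mathcal Z_1,\dots,\mathcal Z_d\subset[0,1]$ be finite non-empty sets such that, in a neighbourhood of each of their points, $f$ is continuous and $\mu$ has a density that is continuous with values in $(0,\infty)$. Let $\psi_j(x)=g_j(\operatorname{dist}(x,\mathcal Z_j))$, where each $g_j$ is one of $g(t)=-\log t$, $g(t)=t^{-1/\alpha}$ (both with $g(0)=+\infty$), $g(t)=D-t^{1/\alpha}$, with $\alpha>0$, $D\in\mathbb R$ (possibly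 depending on $j$). Put $X_{nj}=\psi_j\circ f^n$ and $M_{nj}=\max_{0\le i<n}X_{ij}$, and write $\mathbb X_n,\mathbb M_n$ for the corresponding vectors; inequalities between vectors are componentwise. For $\tau\in[0,\infty)^d\setminus\{0\}$, a sequence $u_n(\tau)=(u_{n1},\dots,u_{nd})\in\mathbb R^d$ is called normalising if $n\,\mu(X_{0j}>u_{nj})\to\tau_j$ for every $j$. Given such a sequence, let $A_n^{(q)}=\{\mathbb X_0\not\le u_n,\ \mathbb X_1\le u_n,\dots,\mathbb X_q\le u_n\}$ for $q\ge 0$ (so $A_n^{(0)}=\{\mathbb X_0\not\le u_n\}$), and for measurable $A,B$ let $R(A)=\inf_{x\in A}\inf\{j\ge1: f^j(x)\in A\}$ and $\mathscr W_{s,\ell}(B)=\bigcap_{i=s}^{s+\max\{\ell-1,0\}}f^{-i}(B^c)$. Then there is a function $\hat\Gamma$ such that for every $\tau\in[0,\infty)^d\setminus\{0\}$: (a) normalising sequences exist, and every normalising sequence $u_n(\tau)$ satisfies $\lim_{n\to\infty} n\,\mu(\mathbb X_0\not\le u_n(\tau))=\hat\Gamma(\tau)$. (b) Let $u_n(\tau)$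 be a normalising sequence for which the limit $\theta(\tau)=\lim_{q\to\infty}\lim_{n\to\infty}\mu(A_n^{(q)})/\mu(A_n^{(0)})$ is well defined. Assume that $p=\min\{j\ge0:\lim_{n\to\infty}R(A_n^{(j)})=\infty\}$ exists and that the indicator functions of $A_n^{(p)}$, $n\ge1$, belong to $\mathcal C$ with uniformly bounded $\mathcal C$-norms. Then the following two conditions hold, with common integers $t_n=t_n^{(q)}\ge1$ satisfying $t_n^{(q)}=o(n)$ for each $q\ge 0$. - (Mixing.) There is $\gamma(q,n,t)$, decreasing in $t$, with $\lim_{q\to\infty}\limsup_{n\to\infty}n\gamma(q,n,t_n^{(q)})=0$ and, for all $\ell,t,n\ge1$ and $q\ge0$, $$\big|\mu(A_n^{(q)}\cap\mathscr W_{t,\ell}(A_n^{(q)}))-\mu(A_n^{(q)})\,\mu(\mathscr W_{0,\ell}(A_n^{(q)}))\big|\le\gamma(q,n,t).$$ - (Cluster separation.) There are integers $k_n\to\infty$ with $k_nt_n^{(q)}=o(n)$ for each $q$ and $$\lim_{q\to\infty}\limsup_{n\to\infty}\ n\sum_{j=q+1}^{\lfloor n/k_n\rfloor-1}\mu\big(A_n^{(q)}\cap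 f^{-j}(A_n^{(q)})\big)=0 .$$ Moreover $$\lim_{n\to\infty}\mu(\mathbb M_n\le u_n(\tau))=e^{-\theta(\tau)\hat\Gamma(\tau)} .$$ -/

import Mathlib

open MeasureTheory Filter Topology Set
open scoped ENNReal unitInterval

namespace MultivariateExtremes

noncomputable section

/-! ### Observables -/

/-- The three standard types of function `g` of the distance to the maximal set:
`-log t`, `t ^ (-1/α)` and `D - t ^ (1/α)`, where `α > 0` and `D ∈ ℝ`. -/
inductive ObservableType where
  | log : ObservableType
  | power (α : ℝ) (hα : 0 < α) : ObservableType
  | bounded (D α : ℝ) (hα : 0 < α) : ObservableType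

/-- The function `g` of the given type, for arguments `t ≥ 0`; the first two types take the value
`+∞` at `t = 0`. -/
def ObservableType.g : ObservableType → ℝ → EReal
  | .log, t => if t = 0 then ⊤ else ((-Real.log t : ℝ) : EReal)
  | .power α _, t => if t = 0 then ⊤ else ((t ^ (-1 / α) : ℝ) : EReal)
  | .bounded D α _, t => ((D - t ^ (1 / α) : ℝ) : EReal)

/-- The vector of observables `ψ_j(x) = g_j(dist(x, Z_j))`. -/
def observable {X : Type*} [PseudoMetricSpace X] {d : ℕ} (g : Fin d → ObservableType)
    (Z : Fin d → Finset X) (j : Fin d) (x : X) : EReal :=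
  (g j).g (Metric.infDist x (Z j : Set X))

section Exceedances

/-! ### The process `X_n = Ψ ∘ f^n`, its maxima and its exceedances

Throughout, `ψ j x` is the `j`-th component of the observable and `u n j` is the `j`-th component
of the `n`-th normalising vector. -/

variable {X : Type*} {d : ℕ}

/-- The componentwise maximum `M_{nj} = max_{0 ≤ i < n} ψ_j ∘ f^i`. -/
def partialMax (f : X → X) (ψ : Fin d → X → EReal) (n : ℕ) (j : Fin d) (x : X) : EReal :=
  (Finset.range n).sup fun i => ψ j (f^[i] x)

/-- The event `{M_n ≤ u_n}` (componentwise). -/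
def maxLE (f : X → X) (ψ : Fin d → X → EReal) (u : ℕ → Fin d → ℝ) (n : ℕ) : Set X :=
  {x | ∀ j, partialMax f ψ n j x ≤ (u n j : EReal)}

/-- The event `A_n^{(q)} = {X_0 ≰ u_n, X_1 ≤ u_n, …, X_q ≤ u_n}`. For `q = 0` it is
`{X_0 ≰ u_n}`: some component exceeds its level. -/
def exceedance (f : X → X) (ψ : Fin d → X → EReal) (u : ℕ → Fin d → ℝ) (q n : ℕ) : Set X :=
  {x | (∃ j, (u n j : EReal) < ψ j x) ∧
    ∀ i, 1 ≤ i → i ≤ q → ∀ j, ψ j (f^[i] x) ≤ (u n j : EReal)}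

/-- `W_{s,ℓ}(B) = ⋂_{i = s}^{s + max(ℓ - 1, 0)} f^{-i}(Bᶜ)`. -/
def noOccurrence (f : X → X) (s ℓ : ℕ) (B : Set X) : Set X :=
  ⋂ i ∈ Finset.Icc s (s + (ℓ - 1)), f^[i] ⁻¹' Bᶜ

/-- The first hitting time `r_A(x) = inf {j ≥ 1 : f^j(x) ∈ A}`, with `inf ∅ = ∞`. -/
def hittingTime (f : X → X) (A : Set X) (x : X) : ℕ∞ :=
  ⨅ (j : ℕ) (_ : 1 ≤ j ∧ f^[j] x ∈ A), (j : ℕ∞)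

/-- The first return `R(A) = inf_{x ∈ A} r_A(x)` from `A` to `A`. -/
def firstReturn (f : X → X) (A : Set X) : ℕ∞ :=
  ⨅ x ∈ A, hittingTime f A x

variable [MeasurableSpace X]

/-- `n μ(ψ_j > u_{nj}) → τ_j` for every component `j`. -/
def IsNormalising (μ : Measure X) (ψ : Fin d → X → EReal) (τ : Fin d → ℝ)
    (u : ℕ → Fin d → ℝ) : Prop :=
  ∀ j, Tendsto (fun n : ℕ => (n : ℝ) * μ.real {x | (u n j : EReal) < ψ j x}) atTop (𝓝 (τ j))

/-- `θ = lim_{q → ∞} lim_{n → ∞} μ(A_n^{(q)}) / μ(A_n^{(0)})`, both limits existing. -/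
def IsExtremalIndex (μ : Measure X) (f : X → X) (ψ : Fin d → X → EReal)
    (u : ℕ → Fin d → ℝ) (θ : ℝ) : Prop :=
  ∃ a : ℕ → ℝ,
    (∀ᶠ q in atTop, Tendsto
      (fun n => μ.real (exceedance f ψ u q n) / μ.real (exceedance f ψ u 0 n)) atTop (𝓝 (a q))) ∧
    Tendsto a atTop (𝓝 θ)

/-- The mixing condition on the levels `u`, realised with the gaps `t q n` (the sequence
`(t_n)_n = (t q n)_n` belongs to the index `q`). -/
def MixingCondition (μ : Measure X) (f : X → X) (ψ : Fin d → X → EReal)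
    (u : ℕ → Fin d → ℝ) (t : ℕ → ℕ → ℕ) : Prop :=
  ∃ γ : ℕ → ℕ → ℕ → ℝ,
    (∀ q n s ℓ : ℕ, 1 ≤ n → 1 ≤ s → 1 ≤ ℓ →
      |μ.real (exceedance f ψ u q n ∩ noOccurrence f s ℓ (exceedance f ψ u q n)) -
        μ.real (exceedance f ψ u q n) *
          μ.real (noOccurrence f 0 ℓ (exceedance f ψ u q n))| ≤ γ q n s) ∧
    (∀ q n, Antitone (γ q n)) ∧
    (∀ q n, 1 ≤ t q n) ∧
    (∀ q, Tendsto (fun n : ℕ => (t q n : ℝ) / n) atTop (𝓝 0)) ∧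
    Tendsto (fun q => limsup (fun n : ℕ => (((n : ℝ) * γ q n (t q n) : ℝ) : EReal)) atTop)
      atTop (𝓝 0)

/-- The cluster separation condition on the levels `u`, relative to the gaps `t q n`. The sum runs
over `q + 1 ≤ j ≤ ⌊n / k_n⌋ - 1`. -/
def ClusterSeparation (μ : Measure X) (f : X → X) (ψ : Fin d → X → EReal)
    (u : ℕ → Fin d → ℝ) (t : ℕ → ℕ → ℕ) : Prop :=
  ∃ k : ℕ → ℕ,
    Tendsto k atTop atTop ∧
    (∀ q, Tendsto (fun n : ℕ => ((k n : ℝ) * t q n) / n) atTop (𝓝 0)) ∧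
    Tendsto (fun q => limsup (fun n : ℕ => (n : ℝ≥0∞) *
        ∑ j ∈ Finset.Ico (q + 1) (n / k n),
          μ (exceedance f ψ u q n ∩ f^[j] ⁻¹' exceedance f ψ u q n)) atTop)
      atTop (𝓝 0)

/-! ### Decay of correlations -/

/-- Summable decay of correlations for observables in `C` against `L¹(μ)`. The Banach space `C` of
integrable functions is given with its own norm and the linear map `ι` that sends an element of `C`
to its class in `L¹(μ)` (so `C` may consist of functions or of classes of functions). -/
def SummableDecay (μ : Measure X) (f : X → X) {C : Type*} [NormedAddCommGroup C]
    [NormedSpace ℝ C] (ι : C →ₗ[ℝ] Lp ℝ 1 μ) : Prop :=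
  ∃ ρ : ℕ → ℝ, (∀ n, 1 ≤ n → 0 < ρ n) ∧ Summable ρ ∧
    ∀ (φ : C) (ψ : X → ℝ), Integrable ψ μ → ∀ n, 1 ≤ n →
      Integrable (fun x => ι φ x * ψ (f^[n] x)) μ ∧
      |∫ x, ι φ x * ψ (f^[n] x) ∂μ - (∫ x, ι φ x ∂μ) * ∫ x, ψ x ∂μ|
        ≤ ρ n * ‖φ‖ * ∫ x, |ψ x| ∂μ

/-- The indicator functions of the sets `A n`, `n ≥ 1`, belong to `C` and their norms in `C` are
uniformly bounded. -/
def BoundedIndicators (μ : Measure X) {C : Type*} [NormedAddCommGroup C]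
    [NormedSpace ℝ C] (ι : C →ₗ[ℝ] Lp ℝ 1 μ) (A : ℕ → Set X) : Prop :=
  ∃ K : ℝ, ∀ n, 1 ≤ n → ∃ φ : C,
    (⇑(ι φ) =ᵐ[μ] (A n).indicator fun _ => (1 : ℝ)) ∧ ‖φ‖ ≤ K

end Exceedances

end

end MultivariateExtremes

/-!
Near its maximal points `μ` gives a ball of radius `r` a mass asymptotic to a multiple of `r`, so
the exceedance set `A_n^{(0)}` is eventually a union of small disjoint balls whose radii are of
order `1 / n`; this gives `Γ̂`.

Since `R(A_n^{(p)}) → ∞`, a point of `A_n^{(p)}` that returns to `A_n^{(0)}` within a fixed time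
must keep visiting it, with gaps at most `p`, for a time that diverges with `n`. By invariance such
points have measure `o(1 / n)`, so `A_n^{(p)}` and `A_n^{(q)}` agree up to `o(1 / n)` for every
`q ≥ p`.

The dependence of `A_n^{(p)}` on the orbit from time `t` on is antitone in `t` and, by decay of
correlations against `L¹`, bounded by a summable rate. It is therefore `o(1 / t)`, which leaves
room for gaps `t_n = o(n)`. The same decay bounds the sum of the probabilities of returning after
time `N` by the tail of the rate, up to the contribution of independence. If `e_ℓ` is the
probability of not visiting `A_n^{(p)}` before time `ℓ`, then `e_{ℓ+1} - e_ℓ` is close to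
`-μ(A_n^{(p)}) e_ℓ`, and the exponential law follows.
-/

namespace MultivariateExtremes

open Asymptotics
open scoped NNReal

theorem exists_tendsto_atTop_eventually {P : ℕ → ℕ → Prop} (hP : ∀ m, ∀ᶠ n in atTop, P m n) :
    ∃ m : ℕ → ℕ, Tendsto m atTop atTop ∧ ∀ᶠ n in atTop, P (m n) n := by
  classical
  refine ⟨fun n => Nat.findGreatest (fun m => P m n) n, tendsto_atTop.2 fun M => ?_, ?_⟩
  · filter_upwards [hP M, eventually_ge_atTop M] with n hPn hn
    exact Nat.le_findGreatest hn hPn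
  · filter_upwards [hP 0] with n hPn
    exact Nat.findGreatest_spec (P := fun m => P m n) (Nat.zero_le n) hPn

theorem exists_tendsto_atTop_eventually_lt {a : ℕ → ℕ∞} (ha : Tendsto a atTop (𝓝 ⊤)) :
    ∃ N : ℕ → ℕ, Tendsto N atTop atTop ∧ ∀ᶠ n in atTop, (N n : ℕ∞) < a n :=
  exists_tendsto_atTop_eventually fun m => ha.eventually (lt_mem_nhds (ENat.natCast_lt_top m))

theorem tendsto_zero_of_tendsto_nat_mul {a : ℕ → ℝ} {s : ℝ}
    (hs : Tendsto (fun n : ℕ => (n : ℝ) * a n) atTop (𝓝 s)) : Tendsto a atTop (𝓝 0) := by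
  have h := (tendsto_inv_atTop_zero.comp (tendsto_natCast_atTop_atTop (R := ℝ))).mul hs
  rw [zero_mul] at h
  refine h.congr' ?_
  filter_upwards [eventually_ne_atTop 0] with n hn
  exact inv_mul_cancel_left₀ (Nat.cast_ne_zero.2 hn) _

theorem sum_le_tsum_nat_add_of_forall_lt {ρ : ℕ → ℝ} (hρ : ∀ n, 1 ≤ n → 0 ≤ ρ n)
    (hs : Summable ρ) {N : ℕ} {J : Finset ℕ} (hJ : ∀ j ∈ J, N < j) :
    ∑ j ∈ J, ρ j ≤ ∑' j, ρ (j + (N + 1)) := by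
  have hsub : ∑ j ∈ J, ρ j = ∑ j ∈ J.image (· - (N + 1)), ρ (j + (N + 1)) := by
    rw [Finset.sum_image fun i hi j hj hij => by have := hJ i hi; have := hJ j hj; omega]
    exact Finset.sum_congr rfl fun j hj => by rw [Nat.sub_add_cancel (hJ j hj)]
  rw [hsub]
  exact ((summable_nat_add_iff (N + 1)).2 hs).sum_le_tsum _ fun j _ => hρ _ (by omega)

theorem nat_mul_le_two_mul_tsum_of_antitone {r ρ : ℕ → ℝ} (hr : Antitone r) (h0 : ∀ n, 0 ≤ r n)
    (hle : ∀ n, 1 ≤ n → r n ≤ ρ n) (hs : Summable ρ) (n : ℕ) :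
    n * r n ≤ 2 * ∑' k, ρ (k + (n / 2 + 1)) := by
  have hterm : ∀ j ∈ Finset.Ico (n / 2 + 1) (n + 1), r n ≤ ρ j := fun j hj => by
    rw [Finset.mem_Ico] at hj
    exact (hr (by omega)).trans (hle j (by omega))
  have hhalf : (n : ℝ) ≤ 2 * ((n + 1 - (n / 2 + 1) : ℕ) : ℝ) := by
    exact_mod_cast (by omega : n ≤ 2 * (n + 1 - (n / 2 + 1)))
  calc n * r n
      ≤ 2 * (((n + 1 - (n / 2 + 1) : ℕ) : ℝ) * r n) := by
        rw [← mul_assoc]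
        exact mul_le_mul_of_nonneg_right hhalf (h0 n)
    _ ≤ 2 * ∑ j ∈ Finset.Ico (n / 2 + 1) (n + 1), ρ j := by
        have hcard := Finset.card_nsmul_le_sum _ _ _ hterm
        rw [Nat.card_Ico, nsmul_eq_mul] at hcard
        linarith
    _ ≤ 2 * ∑' k, ρ (k + (n / 2 + 1)) := by
        have htail := sum_le_tsum_nat_add_of_forall_lt (fun j hj => (h0 j).trans (hle j hj)) hs
          fun j (hj : j ∈ Finset.Ico (n / 2 + 1) (n + 1)) => (Finset.mem_Ico.1 hj).1
        linarith

theorem cast_div_cast_div_le {n c : ℕ} (hc : 1 ≤ c) (hcn : c ≤ n) :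
    (n : ℝ) / (n / c : ℕ) ≤ 2 * c := by
  have hpos : 0 < n / c := Nat.div_pos hcn hc
  have hlt : n < c * (n / c) + c := Nat.lt_mul_div_succ n hc
  have hle : c ≤ c * (n / c) := Nat.le_mul_of_pos_right c hpos
  rw [div_le_iff₀ (Nat.cast_pos.2 hpos)]
  exact_mod_cast (by rw [mul_assoc]; omega : n ≤ 2 * c * (n / c))

theorem exists_gaps {ε : ℕ → ℝ} (hε : Tendsto ε atTop (𝓝 0)) :
    ∃ t k : ℕ → ℕ, (∀ n, 1 ≤ t n) ∧ Tendsto k atTop atTop ∧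
      Tendsto (fun n : ℕ => ((k n : ℝ) * t n) / n) atTop (𝓝 0) ∧
      Tendsto (fun n : ℕ => (n : ℝ) / t n * ε (t n)) atTop (𝓝 0) := by
  have hev : ∀ m : ℕ, ∀ᶠ n : ℕ in atTop, (m + 1) ^ 2 ≤ n ∧
      2 * ((m : ℝ) + 1) ^ 2 * |ε (n / (m + 1) ^ 2)| ≤ 1 / ((m : ℝ) + 1) := fun m => by
    have h := (hε.abs.const_mul (2 * ((m : ℝ) + 1) ^ 2)).comp
      (Nat.tendsto_div_const_atTop (by positivity : (m + 1) ^ 2 ≠ 0))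
    rw [abs_zero, mul_zero] at h
    exact (eventually_ge_atTop _).and (h.eventually (Iic_mem_nhds Nat.one_div_pos_of_nat))
  -- The gap `n / (m + 1) ^ 2` and the number `m + 1` of blocks, with `m = m n` growing slowly.
  obtain ⟨m, hm, hm'⟩ := exists_tendsto_atTop_eventually hev
  have hinv : Tendsto (fun n => 1 / ((m n : ℝ) + 1)) atTop (𝓝 0) :=
    tendsto_one_div_add_atTop_nhds_zero_nat.comp hm
  have hmax : ∀ {n}, (m n + 1) ^ 2 ≤ n → max 1 (n / (m n + 1) ^ 2) = n / (m n + 1) ^ 2 :=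
    fun hn => max_eq_right (Nat.div_pos hn (by positivity))
  refine ⟨fun n => max 1 (n / (m n + 1) ^ 2), fun n => m n + 1, fun n => le_max_left _ _,
    (tendsto_add_atTop_nat 1).comp hm, ?_, ?_⟩
  · refine squeeze_zero' (Eventually.of_forall fun n => by positivity) ?_ hinv
    filter_upwards [hm', eventually_gt_atTop 0] with n hn hn0
    have : (0 : ℝ) < n := Nat.cast_pos.2 hn0
    calc ((m n + 1 : ℕ) : ℝ) * (max 1 (n / (m n + 1) ^ 2) : ℕ) / n
        ≤ ((m n + 1 : ℕ) : ℝ) * (n / ((m n + 1) ^ 2 : ℕ)) / n := by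
          rw [hmax hn.1]
          gcongr
          exact Nat.cast_div_le
      _ = 1 / ((m n : ℝ) + 1) := by
          push_cast
          field_simp
  · refine squeeze_zero_norm' ?_ hinv
    filter_upwards [hm'] with n hn
    rw [hmax hn.1, norm_mul, Real.norm_of_nonneg (by positivity)]
    refine (mul_le_mul_of_nonneg_right (cast_div_cast_div_le ?_ hn.1) (norm_nonneg _)).trans ?_
    · exact Nat.one_le_pow _ _ (Nat.succ_pos _)
    · exact_mod_cast hn.2

theorem tendsto_div_of_tendsto_mul_div {t k : ℕ → ℕ} (hk : Tendsto k atTop atTop)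
    (hkt : Tendsto (fun n : ℕ => ((k n : ℝ) * t n) / n) atTop (𝓝 0)) :
    Tendsto (fun n : ℕ => (t n : ℝ) / n) atTop (𝓝 0) := by
  refine squeeze_zero' (Eventually.of_forall fun n => by positivity) ?_ hkt
  filter_upwards [hk.eventually_ge_atTop 1] with n hn
  gcongr
  exact le_mul_of_one_le_left (Nat.cast_nonneg _) (Nat.one_le_cast.2 hn)

section Sets

variable {X : Type*} {f : X → X} {A B E : Set X}

/-- The points of `E` that do not visit `E` at the times `1, …, q`. For `E = A_n^{(0)}` this is
`A_n^{(q)}`. -/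
def escape (f : X → X) (E : Set X) (q : ℕ) : Set X :=
  {x | x ∈ E ∧ ∀ i, 1 ≤ i → i ≤ q → f^[i] x ∉ E}

theorem escape_subset (E : Set X) (q : ℕ) : escape f E q ⊆ E := fun _ hx => hx.1

theorem escape_anti (E : Set X) {p q : ℕ} (hpq : p ≤ q) : escape f E q ⊆ escape f E p :=
  fun _ hx => ⟨hx.1, fun i h1 hi => hx.2 i h1 (hi.trans hpq)⟩

theorem escape_sdiff_escape_subset (E : Set X) (p q : ℕ) :
    escape f E p \ escape f E q ⊆ ⋃ i ∈ Finset.Icc (p + 1) q, escape f E p ∩ f^[i] ⁻¹' E := by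
  rintro x ⟨hxp, hxq⟩
  obtain ⟨i, h1, hi, hxi⟩ : ∃ i, 1 ≤ i ∧ i ≤ q ∧ f^[i] x ∈ E := by
    by_contra! hnot
    exact hxq ⟨hxp.1, hnot⟩
  have hpi : p < i := not_le.1 fun hip => hxp.2 i h1 hip hxi
  exact mem_biUnion (Finset.mem_coe.2 (Finset.mem_Icc.2 ⟨hpi, hi⟩)) ⟨hxp, hxi⟩

theorem notMem_of_lt_firstReturn {N : ℕ} (hN : (N : ℕ∞) < firstReturn f B) {x : X} (hx : x ∈ B)
    {j : ℕ} (h1 : 1 ≤ j) (hj : j ≤ N) : f^[j] x ∉ B := fun hxj =>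
  hN.not_ge <| calc
    firstReturn f B ≤ hittingTime f B x := iInf₂_le x hx
    _ ≤ j := iInf₂_le j ⟨h1, hxj⟩
    _ ≤ N := Nat.cast_le.2 hj

theorem firstReturn_anti (hAB : A ⊆ B) : firstReturn f B ≤ firstReturn f A :=
  iInf_mono fun _ => le_iInf fun hx => (iInf_le _ (hAB hx)).trans <|
    iInf₂_mono' fun j hj => ⟨j, ⟨hj.1, hAB hj.2⟩, le_rfl⟩

theorem disjoint_preimage_iterate_of_lt_firstReturn {N : ℕ} (hN : (N : ℕ∞) < firstReturn f B)
    {r s : ℕ} (hrs : r < s) (hs : s ≤ r + N) : Disjoint (f^[r] ⁻¹' B) (f^[s] ⁻¹' B) := by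
  refine disjoint_left.2 fun x hxr hxs => ?_
  refine notMem_of_lt_firstReturn hN hxr (j := s - r) (by omega) (by omega) ?_
  rwa [← Function.iterate_add_apply, Nat.sub_add_cancel hrs.le]

theorem exists_iterate_mem_of_lt_firstReturn {p N : ℕ}
    (hN : (N : ℕ∞) < firstReturn f (escape f E p)) {x : X} (hx : x ∈ escape f E p) {i : ℕ}
    (hi : 1 ≤ i) (hxi : f^[i] x ∈ E) {m : ℕ} (him : i ≤ m) (hmN : m ≤ N) :
    ∃ r, 1 ≤ r ∧ r ≤ p ∧ f^[m + r] x ∈ E := by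
  have next_visit : ∀ s, 1 ≤ s → s ≤ N → f^[s] x ∈ E → ∃ r, 1 ≤ r ∧ r ≤ p ∧ f^[s + r] x ∈ E := by
    intro s h1 hs hxs
    by_contra! hnot
    refine notMem_of_lt_firstReturn hN hx h1 hs ⟨hxs, fun r hr1 hrp => ?_⟩
    rw [← Function.iterate_add_apply, add_comm]
    exact hnot r hr1 hrp
  induction m, him using Nat.le_induction with
  | base => exact next_visit i hi hmN hxi
  | succ m _ ih =>
    obtain ⟨r, hr1, hrp, hxr⟩ := ih (by omega)
    rcases hr1.eq_or_lt with rfl | hr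
    · exact next_visit (m + 1) (by omega) hmN hxr
    · exact ⟨r - 1, by omega, by omega, by rwa [show m + 1 + (r - 1) = m + r by omega]⟩

theorem mem_noOccurrence {s ℓ : ℕ} (hℓ : 1 ≤ ℓ) {x : X} :
    x ∈ noOccurrence f s ℓ B ↔ ∀ i, s ≤ i → i < s + ℓ → f^[i] x ∉ B := by
  simp only [noOccurrence, mem_iInter, mem_preimage, mem_compl_iff, Finset.mem_Icc, and_imp]
  exact forall₂_congr fun i _ => ⟨fun h hi => h (by omega), fun h hi => h (by omega)⟩

theorem preimage_noOccurrence (s r ℓ : ℕ) (B : Set X) :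
    f^[r] ⁻¹' noOccurrence f s ℓ B = noOccurrence f (s + r) ℓ B := by
  ext x
  simp only [noOccurrence, mem_preimage, mem_iInter, mem_compl_iff, Finset.mem_Icc, and_imp,
    ← Function.iterate_add_apply]
  refine ⟨fun h i hsi hi => ?_, fun h i hsi hi => h (i + r) (by omega) (by omega)⟩
  obtain ⟨j, rfl⟩ := Nat.exists_eq_add_of_le' (le_of_add_le_right hsi)
  exact h j (by omega) (by omega)

theorem noOccurrence_anti (s ℓ : ℕ) (hAB : A ⊆ B) :
    noOccurrence f s ℓ B ⊆ noOccurrence f s ℓ A :=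
  iInter₂_mono fun _ _ => preimage_mono (compl_subset_compl.2 hAB)

theorem noOccurrence_zero_one (f : X → X) (B : Set X) : noOccurrence f 0 1 B = Bᶜ := by
  simp [noOccurrence]

theorem noOccurrence_zero_succ {ℓ : ℕ} (hℓ : 1 ≤ ℓ) (B : Set X) :
    noOccurrence f 0 (ℓ + 1) B = noOccurrence f 1 ℓ B \ B := by
  ext x
  rw [Set.mem_sdiff, mem_noOccurrence hℓ, mem_noOccurrence (Nat.le_add_left 1 ℓ)]
  refine ⟨fun h => ⟨fun i _ hi => h i (by omega) (by omega), h 0 le_rfl (by omega)⟩, ?_⟩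
  rintro ⟨h, hx⟩ (_ | i) - hi
  · exact hx
  · exact h (i + 1) (by omega) (by omega)

open scoped symmDiff in
theorem symmDiff_noOccurrence_subset {s s' ℓ : ℕ} (hℓ : 1 ≤ ℓ) (hs : s ≤ s') (B : Set X) :
    noOccurrence f s ℓ B ∆ noOccurrence f s' ℓ B ⊆
      ⋃ j ∈ Finset.Ico s s' ∪ Finset.Ico (s + ℓ) (s' + ℓ), f^[j] ⁻¹' B := by
  intro x hx
  simp only [mem_iUnion, mem_preimage, exists_prop, Finset.mem_union, Finset.mem_Ico]
  rw [mem_symmDiff, mem_noOccurrence hℓ, mem_noOccurrence hℓ] at hx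
  contrapose! hx
  exact ⟨fun h i hi hi' => if hlt : i < s + ℓ then h i (by omega) hlt else
      hx i (Or.inr ⟨by omega, hi'⟩),
    fun h i hi hi' => if hlt : i < s' then hx i (Or.inl ⟨hi, hlt⟩) else
      h i (by omega) (by omega)⟩

theorem noOccurrence_escape_sdiff_subset (E : Set X) (p : ℕ) {n : ℕ} (hn : 1 ≤ n) :
    noOccurrence f 0 n (escape f E p) \ noOccurrence f 0 n E ⊆
      ⋃ i ∈ Finset.Ico (n - p) n, f^[i] ⁻¹' E := by
  rintro x ⟨hx, hxE⟩
  rw [mem_noOccurrence hn, zero_add] at hx hxE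
  simp only [mem_iUnion, mem_preimage, exists_prop, Finset.mem_Ico]
  contrapose! hxE
  intro i _ hin
  induction h : n - i using Nat.strong_induction_on generalizing i with
  | _ k ih =>
    intro hxi
    refine hx i (Nat.zero_le _) hin ⟨hxi, fun r hr1 hrp => ?_⟩
    rw [← Function.iterate_add_apply]
    have hip : i < n - p := not_le.1 fun hip => hxE i ⟨hip, hin⟩ hxi
    exact ih _ (by omega) (r + i) (Nat.zero_le _) (by omega) rfl

end Sets

section Measure

variable {X : Type*} [MeasurableSpace X] {f : X → X} {μ : Measure X} {A B E : Set X}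

theorem measurableSet_escape (hf : Measurable f) (hE : MeasurableSet E) (q : ℕ) :
    MeasurableSet (escape f E q) :=
  hE.inter <| measurableSet_setOfPred.2 <| Measurable.forall fun i => Measurable.forall fun _ =>
    Measurable.forall fun _ => measurableSet_setOfPred.1 (hf.iterate i hE).compl

theorem measurableSet_noOccurrence (hf : Measurable f) (hB : MeasurableSet B) (s ℓ : ℕ) :
    MeasurableSet (noOccurrence f s ℓ B) :=
  Finset.measurableSet_biInter _ fun i _ => hf.iterate i hB.compl

theorem measureReal_preimage_iterate (hf : MeasurePreserving f μ μ) (hA : MeasurableSet A) (i : ℕ) :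
    μ.real (f^[i] ⁻¹' A) = μ.real A :=
  (hf.iterate i).measureReal_preimage hA.nullMeasurableSet

theorem measureReal_le_sum_of_subset_biUnion [IsFiniteMeasure μ] {κ : Type*} {J : Finset κ}
    {T : κ → Set X} (hA : A ⊆ ⋃ j ∈ J, T j) : μ.real A ≤ ∑ j ∈ J, μ.real (T j) :=
  (measureReal_mono hA (measure_ne_top _ _)).trans (measureReal_biUnion_finset_le _ _)

theorem sum_measureReal_inter_preimage_le [IsFiniteMeasure μ] (hf : MeasurePreserving f μ μ)
    (hB : MeasurableSet B) (hE : MeasurableSet E) {N : ℕ} (hN : (N : ℕ∞) < firstReturn f B)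
    (i r : ℕ) : ∑ m ∈ Finset.Icc i N, μ.real (B ∩ f^[m + r] ⁻¹' E) ≤ μ.real E := by
  have hmeas : ∀ m, MeasurableSet (B ∩ f^[m + r] ⁻¹' E) := fun m =>
    hB.inter (hf.measurable.iterate _ hE)
  have hdisj : (↑(Finset.Icc i N) : Set ℕ).PairwiseDisjoint
      fun m => f^[N - m] ⁻¹' (B ∩ f^[m + r] ⁻¹' E) := by
    refine pairwiseDisjoint_iff.2 fun a ha b hb hab => ?_
    simp only [Finset.coe_Icc, mem_Icc] at ha hb
    by_contra hne
    rw [preimage_inter, preimage_inter] at hab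
    have hmeet := hab.mono (inter_subset_inter inter_subset_left inter_subset_left)
    rw [← not_disjoint_iff_nonempty_inter] at hmeet
    rcases lt_or_gt_of_ne hne with h | h
    · exact hmeet (disjoint_preimage_iterate_of_lt_firstReturn hN (by omega) (by omega)).symm
    · exact hmeet (disjoint_preimage_iterate_of_lt_firstReturn hN (by omega) (by omega))
  -- Shifting the `m`-th set by `N - m` makes the sets disjoint and keeps them in `f^{-(N + r)} E`.
  calc ∑ m ∈ Finset.Icc i N, μ.real (B ∩ f^[m + r] ⁻¹' E)
      = ∑ m ∈ Finset.Icc i N, μ.real (f^[N - m] ⁻¹' (B ∩ f^[m + r] ⁻¹' E)) :=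
        Finset.sum_congr rfl fun m _ => (measureReal_preimage_iterate hf (hmeas m) _).symm
    _ = μ.real (⋃ m ∈ Finset.Icc i N, f^[N - m] ⁻¹' (B ∩ f^[m + r] ⁻¹' E)) :=
        (measureReal_biUnion_finset hdisj fun m _ => hf.measurable.iterate _ (hmeas m)).symm
    _ ≤ μ.real (f^[N + r] ⁻¹' E) := by
        refine measureReal_mono (iUnion₂_subset fun m hm x hx => ?_)
        rw [Finset.mem_Icc] at hm
        have hxE : f^[m + r] (f^[N - m] x) ∈ E := hx.2
        rwa [← Function.iterate_add_apply, show m + r + (N - m) = N + r by omega] at hxE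
    _ = μ.real E := measureReal_preimage_iterate hf hE _

theorem mul_measureReal_escape_inter_le [IsFiniteMeasure μ] (hf : MeasurePreserving f μ μ)
    (hE : MeasurableSet E) {p N i : ℕ} (hN : (N : ℕ∞) < firstReturn f (escape f E p))
    (hi : 1 ≤ i) :
    ((N + 1 - i : ℕ) : ℝ) * μ.real (escape f E p ∩ f^[i] ⁻¹' E) ≤ p * μ.real E := by
  set S := escape f E p ∩ f^[i] ⁻¹' E
  have hSm : MeasurableSet S :=
    (measurableSet_escape hf.measurable hE p).inter (hf.measurable.iterate i hE)
  have hNS : (N : ℕ∞) < firstReturn f S := hN.trans_le (firstReturn_anti inter_subset_left)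
  -- A point of `S` keeps visiting `E`, with gaps at most `p`, until after the time `N`.
  have hvisit : ∀ m ∈ Finset.Icc i N,
      μ.real S ≤ ∑ r ∈ Finset.Icc 1 p, μ.real (S ∩ f^[m + r] ⁻¹' E) := fun m hm => by
    rw [Finset.mem_Icc] at hm
    refine measureReal_le_sum_of_subset_biUnion fun x hx => ?_
    obtain ⟨r, hr1, hrp, hxr⟩ := exists_iterate_mem_of_lt_firstReturn hN hx.1 hi hx.2 hm.1 hm.2
    exact mem_biUnion (Finset.mem_coe.2 (Finset.mem_Icc.2 ⟨hr1, hrp⟩)) ⟨hx, hxr⟩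
  calc ((N + 1 - i : ℕ) : ℝ) * μ.real S = ∑ _m ∈ Finset.Icc i N, μ.real S := by simp
    _ ≤ ∑ m ∈ Finset.Icc i N, ∑ r ∈ Finset.Icc 1 p, μ.real (S ∩ f^[m + r] ⁻¹' E) :=
        Finset.sum_le_sum hvisit
    _ = ∑ r ∈ Finset.Icc 1 p, ∑ m ∈ Finset.Icc i N, μ.real (S ∩ f^[m + r] ⁻¹' E) :=
        Finset.sum_comm
    _ ≤ ∑ _r ∈ Finset.Icc 1 p, μ.real E := Finset.sum_le_sum fun r _ =>
        sum_measureReal_inter_preimage_le hf hSm hE hNS i r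
    _ = p * μ.real E := by simp

variable [IsFiniteMeasure μ] {E : ℕ → Set X} {p : ℕ} {c : ℝ}

theorem tendsto_nat_mul_measureReal_escape_inter (hf : MeasurePreserving f μ μ)
    (hE : ∀ n, MeasurableSet (E n))
    (hc : Tendsto (fun n : ℕ => (n : ℝ) * μ.real (E n)) atTop (𝓝 c))
    (hret : Tendsto (fun n => firstReturn f (escape f (E n) p)) atTop (𝓝 ⊤)) {i : ℕ}
    (hi : 1 ≤ i) :
    Tendsto (fun n : ℕ => (n : ℝ) * μ.real (escape f (E n) p ∩ f^[i] ⁻¹' E n)) atTop (𝓝 0) := by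
  obtain ⟨N, hN, hNlt⟩ := exists_tendsto_atTop_eventually_lt hret
  have hinv : Tendsto (fun n => ((N n + 1 - i : ℕ) : ℝ)⁻¹) atTop (𝓝 0) :=
    tendsto_inv_atTop_zero.comp <| tendsto_natCast_atTop_atTop.comp <|
      (tendsto_sub_atTop_nat i).comp ((tendsto_add_atTop_nat 1).comp hN)
  have hbound := hinv.mul (hc.const_mul (p : ℝ))
  rw [zero_mul] at hbound
  refine squeeze_zero' (Eventually.of_forall fun n => by positivity) ?_ hbound
  filter_upwards [hNlt, hN.eventually_ge_atTop i] with n hn hin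
  have hpos : (0 : ℝ) < ((N n + 1 - i : ℕ) : ℝ) := Nat.cast_pos.2 (by omega)
  rw [inv_mul_eq_div, le_div_iff₀ hpos]
  calc (n : ℝ) * μ.real (escape f (E n) p ∩ f^[i] ⁻¹' E n) * ((N n + 1 - i : ℕ) : ℝ)
      = n * (((N n + 1 - i : ℕ) : ℝ) * μ.real (escape f (E n) p ∩ f^[i] ⁻¹' E n)) := by ring
    _ ≤ n * (p * μ.real (E n)) := by
        gcongr ?_ * ?_
        exact mul_measureReal_escape_inter_le hf (hE n) hn hi
    _ = p * (n * μ.real (E n)) := by ring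

theorem tendsto_nat_mul_measureReal_escape_sdiff (hf : MeasurePreserving f μ μ)
    (hE : ∀ n, MeasurableSet (E n))
    (hc : Tendsto (fun n : ℕ => (n : ℝ) * μ.real (E n)) atTop (𝓝 c))
    (hret : Tendsto (fun n => firstReturn f (escape f (E n) p)) atTop (𝓝 ⊤)) (q : ℕ) :
    Tendsto (fun n : ℕ => (n : ℝ) * μ.real (escape f (E n) p \ escape f (E n) q))
      atTop (𝓝 0) := by
  have hsum : Tendsto (fun n : ℕ => ∑ i ∈ Finset.Icc (p + 1) q,
      (n : ℝ) * μ.real (escape f (E n) p ∩ f^[i] ⁻¹' E n)) atTop (𝓝 0) := by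
    simpa only [Finset.sum_const_zero] using tendsto_finsetSum (Finset.Icc (p + 1) q) fun i hi =>
      tendsto_nat_mul_measureReal_escape_inter hf hE hc hret
        (le_of_add_le_right (Finset.mem_Icc.1 hi).1)
  refine squeeze_zero (fun n => by positivity) (fun n => ?_) hsum
  rw [← Finset.mul_sum]
  gcongr
  exact measureReal_le_sum_of_subset_biUnion (escape_sdiff_escape_subset (E n) p q)

end Measure

section Decay

variable {X : Type*} [MeasurableSpace X] {f : X → X} {μ : Measure X} {ρ : ℕ → ℝ} {B P Q : Set X}

/-- Correlations of the indicator of `B` against indicators of measurable sets decay with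
rate `ρ`. This is what is used of the decay of correlations. -/
def IndicatorDecay (μ : Measure X) (f : X → X) (ρ : ℕ → ℝ) (B : Set X) : Prop :=
  ∀ s, 1 ≤ s → ∀ G, MeasurableSet G →
    |μ.real (B ∩ f^[s] ⁻¹' G) - μ.real B * μ.real G| ≤ ρ s * μ.real G

/-- The dependence between `B` and the events determined by the orbit from the time `t` on. Its
monotonicity in `t` makes it a mixing rate even if the rate of decay is not monotone. -/
noncomputable def mixingCoeff (μ : Measure X) (f : X → X) (B : Set X) (t : ℕ) : ℝ :=
  ⨆ G : {G : Set X // MeasurableSet G}, |μ.real (B ∩ f^[t] ⁻¹' G) - μ.real B * μ.real G.1|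

theorem mixingCoeff_nonneg (μ : Measure X) (f : X → X) (B : Set X) (t : ℕ) :
    0 ≤ mixingCoeff μ f B t :=
  Real.iSup_nonneg fun _ => abs_nonneg _

theorem IndicatorDecay.sum_inter_le (h : IndicatorDecay μ f ρ B) (hρ : ∀ n, 1 ≤ n → 0 ≤ ρ n)
    (hs : Summable ρ) {G : Set X} (hG : MeasurableSet G) {N : ℕ} {J : Finset ℕ}
    (hJ : ∀ j ∈ J, N < j) :
    ∑ j ∈ J, μ.real (B ∩ f^[j] ⁻¹' G) ≤
      J.card * (μ.real B * μ.real G) + μ.real G * ∑' j, ρ (j + (N + 1)) :=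
  calc ∑ j ∈ J, μ.real (B ∩ f^[j] ⁻¹' G)
      ≤ ∑ j ∈ J, (μ.real B * μ.real G + μ.real G * ρ j) := Finset.sum_le_sum fun j hj => by
        linarith [(abs_le.1 (h j (by have := hJ j hj; omega) G hG)).2]
    _ = J.card * (μ.real B * μ.real G) + μ.real G * ∑ j ∈ J, ρ j := by
        rw [Finset.sum_add_distrib, Finset.sum_const, nsmul_eq_mul, ← Finset.mul_sum]
    _ ≤ J.card * (μ.real B * μ.real G) + μ.real G * ∑' j, ρ (j + (N + 1)) := by
        gcongr
        exact sum_le_tsum_nat_add_of_forall_lt hρ hs hJ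

theorem IndicatorDecay.sum_inter_self_le (h : IndicatorDecay μ f ρ B) (hB : MeasurableSet B)
    (hρ : ∀ n, 1 ≤ n → 0 ≤ ρ n) (hs : Summable ρ) {N : ℕ} (hN : (N : ℕ∞) < firstReturn f B)
    {J : Finset ℕ} (hJ : ∀ j ∈ J, 1 ≤ j) :
    ∑ j ∈ J, μ.real (B ∩ f^[j] ⁻¹' B) ≤
      J.card * μ.real B ^ 2 + μ.real B * ∑' j, ρ (j + (N + 1)) := by
  have hlate : ∀ j ∈ J, μ.real (B ∩ f^[j] ⁻¹' B) ≠ 0 → N < j := fun j hj hne => by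
    obtain ⟨x, hx, hxj⟩ := nonempty_of_measureReal_ne_zero hne
    exact not_le.1 fun hjN => notMem_of_lt_firstReturn hN hx (hJ j hj) hjN hxj
  rw [← Finset.sum_filter_of_ne hlate, sq]
  refine (h.sum_inter_le hρ hs hB fun j hj => (Finset.mem_filter.1 hj).2).trans ?_
  gcongr
  exact Finset.filter_subset _ _

variable [IsProbabilityMeasure μ]

theorem abs_sub_le_mixingCoeff (μ : Measure X) [IsProbabilityMeasure μ] (f : X → X) (B : Set X)
    (t : ℕ) {G : Set X} (hG : MeasurableSet G) :
    |μ.real (B ∩ f^[t] ⁻¹' G) - μ.real B * μ.real G| ≤ mixingCoeff μ f B t := by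
  refine le_ciSup (f := fun G : {G : Set X // MeasurableSet G} =>
    |μ.real (B ∩ f^[t] ⁻¹' G) - μ.real B * μ.real G.1|) ⟨1, ?_⟩ ⟨G, hG⟩
  rintro _ ⟨G, rfl⟩
  exact abs_sub_le_of_nonneg_of_le measureReal_nonneg measureReal_le_one (by positivity)
    (mul_le_one₀ measureReal_le_one measureReal_nonneg measureReal_le_one)

theorem mixingCoeff_antitone (hf : MeasurePreserving f μ μ) (B : Set X) :
    Antitone (mixingCoeff μ f B) := fun s t hst => ciSup_le fun ⟨G, hG⟩ => by
  have h := abs_sub_le_mixingCoeff μ f B s (hf.measurable.iterate (t - s) hG)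
  rwa [measureReal_preimage_iterate hf hG, ← preimage_comp, ← Function.iterate_add,
    Nat.sub_add_cancel hst] at h

theorem mixingCoeff_le_add_measureReal_sdiff (f : X → X) (hQ : MeasurableSet Q) (hQP : Q ⊆ P)
    (t : ℕ) : mixingCoeff μ f Q t ≤ mixingCoeff μ f P t + μ.real (P \ Q) :=
  ciSup_le fun ⟨G, hG⟩ => by
    have hV : ∀ V : Set X, μ.real (P ∩ V) = μ.real (Q ∩ V) + μ.real ((P ∩ V) \ Q) := fun V => by
      rw [← measureReal_inter_add_sdiff hQ, inter_right_comm, inter_eq_right.2 hQP]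
    have hinter := hV (f^[t] ⁻¹' G)
    have hself : μ.real P = μ.real Q + μ.real (P \ Q) := by simpa using hV univ
    have hle : μ.real ((P ∩ f^[t] ⁻¹' G) \ Q) ≤ μ.real (P \ Q) :=
      measureReal_mono (sdiff_subset_sdiff_left inter_subset_left)
    have hmul : μ.real (P \ Q) * μ.real G ≤ μ.real (P \ Q) :=
      mul_le_of_le_one_right measureReal_nonneg measureReal_le_one
    have hmul' : 0 ≤ μ.real (P \ Q) * μ.real G := by positivity
    have hmix := abs_le.1 (abs_sub_le_mixingCoeff μ f P t hG)
    have hnonneg : 0 ≤ μ.real ((P ∩ f^[t] ⁻¹' G) \ Q) := measureReal_nonneg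
    rw [hinter, hself, add_mul] at hmix
    exact abs_le.2 ⟨by linarith [hmix.1], by linarith [hmix.2]⟩

theorem IndicatorDecay.mixingCoeff_le (h : IndicatorDecay μ f ρ B) {t : ℕ} (ht : 1 ≤ t)
    (hρ : 0 ≤ ρ t) : mixingCoeff μ f B t ≤ ρ t :=
  ciSup_le fun ⟨G, hG⟩ => (h t ht G hG).trans (mul_le_of_le_one_right hρ measureReal_le_one)

theorem exists_gaps_tendsto_nat_mul_mixingCoeff (hf : MeasurePreserving f μ μ)
    (hρ : ∀ n, 1 ≤ n → 0 ≤ ρ n) (hs : Summable ρ) {B : ℕ → Set X}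
    (hB : ∀ n, 1 ≤ n → IndicatorDecay μ f ρ (B n)) :
    ∃ t k : ℕ → ℕ, (∀ n, 1 ≤ t n) ∧ Tendsto k atTop atTop ∧
      Tendsto (fun n : ℕ => ((k n : ℝ) * t n) / n) atTop (𝓝 0) ∧
      Tendsto (fun n : ℕ => (n : ℝ) * mixingCoeff μ f (B n) (t n)) atTop (𝓝 0) := by
  have htail : Tendsto (fun t : ℕ => 2 * ∑' k, ρ (k + (t / 2 + 1))) atTop (𝓝 0) := by
    simpa using ((tendsto_sum_nat_add ρ).comp ((tendsto_add_atTop_nat 1).comp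
      (Nat.tendsto_div_const_atTop two_ne_zero))).const_mul 2
  obtain ⟨t, k, ht, hk, hkt, hgap⟩ := exists_gaps htail
  refine ⟨t, k, ht, hk, hkt, squeeze_zero' (Eventually.of_forall fun n =>
    mul_nonneg n.cast_nonneg (mixingCoeff_nonneg _ _ _ _)) ?_ hgap⟩
  filter_upwards [eventually_ge_atTop 1] with n hn
  have hrate := nat_mul_le_two_mul_tsum_of_antitone (mixingCoeff_antitone hf (B n))
    (mixingCoeff_nonneg μ f (B n)) (fun s h1 => (hB n hn).mixingCoeff_le h1 (hρ s h1)) hs (t n)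
  have ht0 : (t n : ℝ) ≠ 0 := Nat.cast_ne_zero.2 (Nat.one_le_iff_ne_zero.1 (ht n))
  calc (n : ℝ) * mixingCoeff μ f (B n) (t n)
      = n / t n * (t n * mixingCoeff μ f (B n) (t n)) := by field_simp
    _ ≤ n / t n * (2 * ∑' k, ρ (k + (t n / 2 + 1))) := by gcongr

theorem IndicatorDecay.abs_sub_noOccurrence_le (hf : MeasurePreserving f μ μ)
    (h : IndicatorDecay μ f ρ B) (hB : MeasurableSet B)
    (hρ : ∀ n, 1 ≤ n → 0 ≤ ρ n) (hs : Summable ρ) {N : ℕ} (hN : (N : ℕ∞) < firstReturn f B)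
    {t ℓ : ℕ} (ht : 1 ≤ t) (hℓ : 1 ≤ ℓ) :
    |μ.real (B ∩ noOccurrence f 1 ℓ B) - μ.real B * μ.real (noOccurrence f 0 ℓ B)| ≤
      2 * t * μ.real B ^ 2 + μ.real B * ∑' j, ρ (j + (N + 1)) + mixingCoeff μ f B t := by
  have hm : ∀ s, MeasurableSet (noOccurrence f s ℓ B) :=
    fun s => measurableSet_noOccurrence hf.measurable hB s ℓ
  have hmix : |μ.real (B ∩ noOccurrence f t ℓ B) - μ.real B * μ.real (noOccurrence f 0 ℓ B)| ≤
      mixingCoeff μ f B t := by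
    simpa only [preimage_noOccurrence, zero_add] using abs_sub_le_mixingCoeff μ f B t (hm 0)
  set J := Finset.Ico 1 t ∪ Finset.Ico (1 + ℓ) (t + ℓ) with hJ
  have hcard : (J.card : ℝ) ≤ 2 * t := by
    have hle := Finset.card_union_le (Finset.Ico 1 t) (Finset.Ico (1 + ℓ) (t + ℓ))
    rw [← hJ, Nat.card_Ico, Nat.card_Ico] at hle
    exact_mod_cast (by omega : J.card ≤ 2 * t)
  have hshift : |μ.real (B ∩ noOccurrence f 1 ℓ B) - μ.real (B ∩ noOccurrence f t ℓ B)| ≤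
      2 * t * μ.real B ^ 2 + μ.real B * ∑' j, ρ (j + (N + 1)) :=
    calc |μ.real (B ∩ noOccurrence f 1 ℓ B) - μ.real (B ∩ noOccurrence f t ℓ B)|
        ≤ μ.real (symmDiff (B ∩ noOccurrence f 1 ℓ B) (B ∩ noOccurrence f t ℓ B)) :=
          abs_measureReal_sub_le_measureReal_symmDiff (hB.inter (hm 1)).nullMeasurableSet
            (hB.inter (hm t)).nullMeasurableSet
      _ ≤ ∑ j ∈ J, μ.real (B ∩ f^[j] ⁻¹' B) := by
          refine measureReal_le_sum_of_subset_biUnion ?_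
          rw [← inter_symmDiff_distrib_left, ← inter_iUnion₂]
          exact inter_subset_inter_right B (symmDiff_noOccurrence_subset hℓ ht B)
      _ ≤ J.card * μ.real B ^ 2 + μ.real B * ∑' j, ρ (j + (N + 1)) :=
          h.sum_inter_self_le hB hρ hs hN fun j hj => by
            simp only [hJ, Finset.mem_union, Finset.mem_Ico] at hj
            omega
      _ ≤ 2 * t * μ.real B ^ 2 + μ.real B * ∑' j, ρ (j + (N + 1)) := by gcongr
  exact (abs_sub_le _ _ _).trans (add_le_add hshift hmix)

theorem abs_noOccurrence_sub_pow_le (hf : MeasurePreserving f μ μ) (hB : MeasurableSet B) {e : ℝ}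
    (he : ∀ ℓ, 1 ≤ ℓ →
      |μ.real (B ∩ noOccurrence f 1 ℓ B) - μ.real B * μ.real (noOccurrence f 0 ℓ B)| ≤ e)
    {ℓ : ℕ} (hℓ : 1 ≤ ℓ) :
    |μ.real (noOccurrence f 0 ℓ B) - (1 - μ.real B) ^ ℓ| ≤ ℓ * e := by
  induction ℓ, hℓ using Nat.le_induction with
  | base =>
    rw [noOccurrence_zero_one, probReal_compl_eq_one_sub hB, pow_one, sub_self, abs_zero,
      Nat.cast_one, one_mul]
    exact (abs_nonneg _).trans (he 1 le_rfl)
  | succ ℓ hℓ ih =>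
    have hstep : μ.real (noOccurrence f 0 (ℓ + 1) B) =
        μ.real (noOccurrence f 0 ℓ B) - μ.real (B ∩ noOccurrence f 1 ℓ B) := by
      rw [noOccurrence_zero_succ hℓ, ← zero_add 1, ← preimage_noOccurrence, eq_sub_iff_add_eq,
        inter_comm, measureReal_sdiff_add_inter hB, measureReal_preimage_iterate hf
          (measurableSet_noOccurrence hf.measurable hB 0 ℓ)]
    have hb0 : 0 ≤ 1 - μ.real B := sub_nonneg.2 measureReal_le_one
    have hb1 : 1 - μ.real B ≤ 1 := sub_le_self _ measureReal_nonneg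
    calc |μ.real (noOccurrence f 0 (ℓ + 1) B) - (1 - μ.real B) ^ (ℓ + 1)|
        = |(1 - μ.real B) * (μ.real (noOccurrence f 0 ℓ B) - (1 - μ.real B) ^ ℓ) -
            (μ.real (B ∩ noOccurrence f 1 ℓ B) -
              μ.real B * μ.real (noOccurrence f 0 ℓ B))| := by
          rw [hstep]
          ring_nf
      _ ≤ (1 - μ.real B) * |μ.real (noOccurrence f 0 ℓ B) - (1 - μ.real B) ^ ℓ| + e := by
          refine (abs_sub _ _).trans (add_le_add ?_ (he ℓ hℓ))
          rw [abs_mul, abs_of_nonneg hb0]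
      _ ≤ 1 * (ℓ * e) + e := by gcongr
      _ = (ℓ + 1 : ℕ) * e := by
          push_cast
          ring

theorem tendsto_noOccurrence_exp (hf : MeasurePreserving f μ μ) {B : ℕ → Set X}
    (hB : ∀ n, MeasurableSet (B n)) (hρ : ∀ n, 1 ≤ n → 0 ≤ ρ n) (hs : Summable ρ)
    (hdec : ∀ n, 1 ≤ n → IndicatorDecay μ f ρ (B n)) {c : ℝ}
    (hc : Tendsto (fun n : ℕ => (n : ℝ) * μ.real (B n)) atTop (𝓝 c))
    (hret : Tendsto (fun n => firstReturn f (B n)) atTop (𝓝 ⊤)) :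
    Tendsto (fun n => μ.real (noOccurrence f 0 n (B n))) atTop (𝓝 (Real.exp (-c))) := by
  obtain ⟨t, k, ht1, hk, hkt, hmix⟩ := exists_gaps_tendsto_nat_mul_mixingCoeff hf hρ hs hdec
  obtain ⟨N, hN, hNlt⟩ := exists_tendsto_atTop_eventually_lt hret
  have hpow : Tendsto (fun n : ℕ => (1 - μ.real (B n)) ^ n) atTop (𝓝 (Real.exp (-c))) := by
    simpa only [sub_eq_add_neg] using Real.tendsto_one_add_pow_exp_of_tendsto
      (g := fun n => -μ.real (B n)) (by simpa only [mul_neg] using hc.neg)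
  have htail : Tendsto (fun n => ∑' j, ρ (j + (N n + 1))) atTop (𝓝 0) :=
    (tendsto_sum_nat_add ρ).comp ((tendsto_add_atTop_nat 1).comp hN)
  have herr : Tendsto (fun n : ℕ => (n : ℝ) * (2 * t n * μ.real (B n) ^ 2 +
      μ.real (B n) * ∑' j, ρ (j + (N n + 1)) + mixingCoeff μ f (B n) (t n))) atTop (𝓝 0) := by
    have h := ((((tendsto_div_of_tendsto_mul_div hk hkt).const_mul 2).mul (hc.pow 2)).add
      (hc.mul htail)).add hmix
    simp only [zero_mul, mul_zero, add_zero] at h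
    refine h.congr' ?_
    filter_upwards [eventually_ne_atTop 0] with n hn
    field_simp
  have hdiff : Tendsto (fun n => μ.real (noOccurrence f 0 n (B n)) - (1 - μ.real (B n)) ^ n)
      atTop (𝓝 0) := by
    refine squeeze_zero_norm' ?_ herr
    filter_upwards [hNlt, eventually_ge_atTop 1] with n hn hn1
    exact abs_noOccurrence_sub_pow_le hf (hB n) (fun ℓ hℓ =>
      (hdec n hn1).abs_sub_noOccurrence_le hf (hB n) hρ hs hn (ht1 n) hℓ) hn1
  simpa only [sub_add_cancel, zero_add] using hdiff.add hpow

theorem SummableDecay.exists_indicatorDecay {C : Type*} [NormedAddCommGroup C] [NormedSpace ℝ C]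
    {ι : C →ₗ[ℝ] Lp ℝ 1 μ} (hdecay : SummableDecay μ f ι) (hf : MeasurePreserving f μ μ)
    {A : ℕ → Set X} (hA : ∀ n, MeasurableSet (A n)) (hbdd : BoundedIndicators μ ι A) :
    ∃ ρ : ℕ → ℝ, (∀ n, 1 ≤ n → 0 ≤ ρ n) ∧ Summable ρ ∧
      ∀ n, 1 ≤ n → IndicatorDecay μ f ρ (A n) := by
  obtain ⟨ρ, hρ, hs, hdec⟩ := hdecay
  obtain ⟨K, hK⟩ := hbdd
  have hK0 : 0 ≤ K := by
    obtain ⟨φ, -, hφK⟩ := hK 1 le_rfl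
    exact (norm_nonneg φ).trans hφK
  refine ⟨fun n => ρ n * K, fun n hn => mul_nonneg (hρ n hn).le hK0, hs.mul_right K,
    fun n hn s h1 G hG => ?_⟩
  obtain ⟨φ, hφ, hφK⟩ := hK n hn
  have h := (hdec φ (G.indicator 1) ((integrable_const 1).indicator hG) s h1).2
  have hcorr : ∫ x, ι φ x * G.indicator (1 : X → ℝ) (f^[s] x) ∂μ = μ.real (A n ∩ f^[s] ⁻¹' G) := by
    rw [← integral_indicator_one ((hA n).inter (hf.measurable.iterate s hG)),
      inter_indicator_one]
    exact integral_congr_ae (hφ.mono fun x hx => congrArg (· * _) hx)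
  have hφA : ∫ x, ι φ x ∂μ = μ.real (A n) := by
    rw [integral_congr_ae hφ]
    exact integral_indicator_one (hA n)
  have hGabs : ∀ x, |G.indicator (1 : X → ℝ) x| = G.indicator 1 x := fun x =>
    abs_of_nonneg (indicator_nonneg (fun _ _ => zero_le_one) x)
  simp only [hGabs, hcorr, hφA, integral_indicator_one hG] at h
  have hρs := (hρ s h1).le
  exact h.trans (by dsimp only; gcongr)

end Decay

section Exceedances

variable {X : Type*} {f : X → X} {d : ℕ} {ψ : Fin d → X → EReal} {u : ℕ → Fin d → ℝ}

theorem exceedance_zero (f : X → X) (ψ : Fin d → X → EReal) (u : ℕ → Fin d → ℝ) (n : ℕ) :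
    exceedance f ψ u 0 n = {x | ∃ j, (u n j : EReal) < ψ j x} := by
  ext x
  simp only [exceedance, mem_ofPred_eq, and_iff_left_iff_imp]
  exact fun _ i h1 h0 => absurd (h1.trans h0) (by decide)

theorem exceedance_eq_escape (q n : ℕ) :
    exceedance f ψ u q n = escape f (exceedance f ψ u 0 n) q := by
  simp only [escape, exceedance_zero, mem_ofPred_eq, not_exists, not_lt]
  rfl

theorem exceedance_anti {p q : ℕ} (hpq : p ≤ q) (n : ℕ) :
    exceedance f ψ u q n ⊆ exceedance f ψ u p n := by
  rw [exceedance_eq_escape q, exceedance_eq_escape p]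
  exact escape_anti _ hpq

theorem maxLE_eq_noOccurrence {n : ℕ} (hn : 1 ≤ n) :
    maxLE f ψ u n = noOccurrence f 0 n (exceedance f ψ u 0 n) := by
  ext x
  rw [mem_noOccurrence hn]
  simp only [maxLE, partialMax, exceedance_zero, mem_ofPred_eq, Finset.sup_le_iff,
    Finset.mem_range, not_exists, not_lt, zero_add, Nat.zero_le, true_imp_iff]
  exact ⟨fun h i hi j => h j i hi, fun h j i hi => h i hi j⟩

variable [MeasurableSpace X] {μ : Measure X} {ρ : ℕ → ℝ} {c : ℝ} {p : ℕ}

theorem measurableSet_exceedance (hf : Measurable f)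
    (hE : ∀ n, MeasurableSet (exceedance f ψ u 0 n)) (q n : ℕ) :
    MeasurableSet (exceedance f ψ u q n) := by
  rw [exceedance_eq_escape]
  exact measurableSet_escape hf (hE n) q

variable [IsProbabilityMeasure μ]

theorem tendsto_nat_mul_measureReal_exceedance_sdiff (hf : MeasurePreserving f μ μ)
    (hE : ∀ n, MeasurableSet (exceedance f ψ u 0 n))
    (hc : Tendsto (fun n : ℕ => (n : ℝ) * μ.real (exceedance f ψ u 0 n)) atTop (𝓝 c))
    (hret : Tendsto (fun n => firstReturn f (exceedance f ψ u p n)) atTop (𝓝 ⊤)) (q : ℕ) :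
    Tendsto (fun n : ℕ => (n : ℝ) * μ.real (exceedance f ψ u p n \ exceedance f ψ u q n))
      atTop (𝓝 0) := by
  simp only [exceedance_eq_escape p, exceedance_eq_escape q] at hret ⊢
  exact tendsto_nat_mul_measureReal_escape_sdiff hf hE hc hret q

theorem mixingCondition_of_tendsto_mixingCoeff (hf : MeasurePreserving f μ μ)
    (hE : ∀ n, MeasurableSet (exceedance f ψ u 0 n))
    (hc : Tendsto (fun n : ℕ => (n : ℝ) * μ.real (exceedance f ψ u 0 n)) atTop (𝓝 c))
    (hret : Tendsto (fun n => firstReturn f (exceedance f ψ u p n)) atTop (𝓝 ⊤))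
    {t : ℕ → ℕ} (ht1 : ∀ n, 1 ≤ t n) (ht : Tendsto (fun n : ℕ => (t n : ℝ) / n) atTop (𝓝 0))
    (hmix : Tendsto (fun n : ℕ => (n : ℝ) * mixingCoeff μ f (exceedance f ψ u p n) (t n))
      atTop (𝓝 0)) :
    MixingCondition μ f ψ u fun _ => t := by
  have hm := measurableSet_exceedance hf.measurable hE
  refine ⟨fun q n => mixingCoeff μ f (exceedance f ψ u q n), fun q n s ℓ _ _ _ => ?_,
    fun q n => mixingCoeff_antitone hf _, fun _ => ht1, fun _ => ht,
    tendsto_const_nhds.congr' ?_⟩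
  · simpa only [preimage_noOccurrence, zero_add] using abs_sub_le_mixingCoeff μ f _ s
      (measurableSet_noOccurrence hf.measurable (hm q n) 0 ℓ)
  · filter_upwards [eventually_ge_atTop p] with q hpq
    have hbound := hmix.add (tendsto_nat_mul_measureReal_exceedance_sdiff hf hE hc hret q)
    simp only [add_zero, ← mul_add] at hbound
    have hlim : Tendsto (fun n : ℕ => (n : ℝ) * mixingCoeff μ f (exceedance f ψ u q n) (t n))
        atTop (𝓝 0) :=
      squeeze_zero (fun n => mul_nonneg n.cast_nonneg (mixingCoeff_nonneg _ _ _ _)) (fun n =>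
        mul_le_mul_of_nonneg_left (mixingCoeff_le_add_measureReal_sdiff f (hm q n)
          (exceedance_anti hpq n) (t n)) n.cast_nonneg) hbound
    exact (continuous_coe_real_ereal.continuousAt.tendsto.comp hlim).limsup_eq.symm

theorem sum_measureReal_exceedance_inter_le (hf : Measurable f)
    (hE : ∀ n, MeasurableSet (exceedance f ψ u 0 n)) (hρ : ∀ n, 1 ≤ n → 0 ≤ ρ n)
    (hs : Summable ρ) {n : ℕ} (hdec : IndicatorDecay μ f ρ (exceedance f ψ u p n)) {q : ℕ}
    (hpq : p ≤ q) (b : ℕ) :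
    ∑ j ∈ Finset.Ico (q + 1) b,
        μ.real (exceedance f ψ u q n ∩ f^[j] ⁻¹' exceedance f ψ u q n) ≤
      b * μ.real (exceedance f ψ u 0 n) ^ 2 +
        μ.real (exceedance f ψ u 0 n) * ∑' j, ρ (j + (q + 1)) := by
  have hle : ∀ r, μ.real (exceedance f ψ u r n) ≤ μ.real (exceedance f ψ u 0 n) := fun r =>
    measureReal_mono (exceedance_anti r.zero_le n)
  have htail : 0 ≤ ∑' j, ρ (j + (q + 1)) := tsum_nonneg fun j => hρ _ (by omega)
  have hcard : (Finset.Ico (q + 1) b).card ≤ b := by simp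
  calc ∑ j ∈ Finset.Ico (q + 1) b,
        μ.real (exceedance f ψ u q n ∩ f^[j] ⁻¹' exceedance f ψ u q n)
      ≤ ∑ j ∈ Finset.Ico (q + 1) b,
          μ.real (exceedance f ψ u p n ∩ f^[j] ⁻¹' exceedance f ψ u q n) :=
        Finset.sum_le_sum fun j _ =>
          measureReal_mono (inter_subset_inter_left _ (exceedance_anti hpq n))
    _ ≤ (Finset.Ico (q + 1) b).card *
            (μ.real (exceedance f ψ u p n) * μ.real (exceedance f ψ u q n)) +
          μ.real (exceedance f ψ u q n) * ∑' j, ρ (j + (q + 1)) :=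
        hdec.sum_inter_le hρ hs (measurableSet_exceedance hf hE q n) fun j hj =>
          (Finset.mem_Ico.1 hj).1
    _ ≤ b * μ.real (exceedance f ψ u 0 n) ^ 2 +
          μ.real (exceedance f ψ u 0 n) * ∑' j, ρ (j + (q + 1)) := by
        have hp := hle p
        have hq := hle q
        rw [sq]
        gcongr

theorem limsup_sum_measure_exceedance_inter_le (hf : Measurable f)
    (hE : ∀ n, MeasurableSet (exceedance f ψ u 0 n))
    (hρ : ∀ n, 1 ≤ n → 0 ≤ ρ n) (hs : Summable ρ)
    (hdec : ∀ n, 1 ≤ n → IndicatorDecay μ f ρ (exceedance f ψ u p n))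
    (hc : Tendsto (fun n : ℕ => (n : ℝ) * μ.real (exceedance f ψ u 0 n)) atTop (𝓝 c))
    {k : ℕ → ℕ} (hk : Tendsto k atTop atTop) {q : ℕ} (hpq : p ≤ q) :
    limsup (fun n : ℕ => (n : ℝ≥0∞) * ∑ j ∈ Finset.Ico (q + 1) (n / k n),
        μ (exceedance f ψ u q n ∩ f^[j] ⁻¹' exceedance f ψ u q n)) atTop ≤
      ENNReal.ofReal (c * ∑' j, ρ (j + (q + 1))) := by
  set e : ℕ → ℝ := fun n => μ.real (exceedance f ψ u 0 n)
  set bound : ℕ → ℝ := fun n =>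
    (n * e n) ^ 2 * (k n : ℝ)⁻¹ + n * e n * ∑' j, ρ (j + (q + 1)) with hbound
  have hlim : Tendsto bound atTop (𝓝 (c * ∑' j, ρ (j + (q + 1)))) := by
    simpa only [mul_zero, zero_add, Function.comp_apply] using
      ((hc.pow 2).mul (tendsto_inv_atTop_zero.comp
        (tendsto_natCast_atTop_atTop.comp hk))).add (hc.mul_const (∑' j, ρ (j + (q + 1))))
  rw [← (ENNReal.tendsto_ofReal hlim).limsup_eq]
  refine limsup_le_limsup ?_
  filter_upwards [eventually_ge_atTop 1] with n hn
  simp only [← ofReal_measureReal (measure_ne_top μ _), ← ENNReal.ofReal_natCast n]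
  rw [← ENNReal.ofReal_sum_of_nonneg fun _ _ => measureReal_nonneg,
    ← ENNReal.ofReal_mul n.cast_nonneg]
  refine ENNReal.ofReal_le_ofReal ?_
  calc (n : ℝ) * ∑ j ∈ Finset.Ico (q + 1) (n / k n),
        μ.real (exceedance f ψ u q n ∩ f^[j] ⁻¹' exceedance f ψ u q n)
      ≤ n * ((n / k n : ℕ) * e n ^ 2 + e n * ∑' j, ρ (j + (q + 1))) := by
        gcongr
        exact sum_measureReal_exceedance_inter_le hf hE hρ hs (hdec n hn) hpq _
    _ ≤ n * ((n / k n : ℝ) * e n ^ 2 + e n * ∑' j, ρ (j + (q + 1))) := by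
        gcongr
        exact Nat.cast_div_le
    _ = bound n := by
        simp only [hbound]
        ring

theorem clusterSeparation_of_indicatorDecay (hf : Measurable f)
    (hE : ∀ n, MeasurableSet (exceedance f ψ u 0 n))
    (hρ : ∀ n, 1 ≤ n → 0 ≤ ρ n) (hs : Summable ρ)
    (hdec : ∀ n, 1 ≤ n → IndicatorDecay μ f ρ (exceedance f ψ u p n))
    (hc : Tendsto (fun n : ℕ => (n : ℝ) * μ.real (exceedance f ψ u 0 n)) atTop (𝓝 c))
    {t k : ℕ → ℕ} (hk : Tendsto k atTop atTop)
    (hkt : Tendsto (fun n : ℕ => ((k n : ℝ) * t n) / n) atTop (𝓝 0)) :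
    ClusterSeparation μ f ψ u fun _ => t := by
  have htail : Tendsto (fun q : ℕ => ENNReal.ofReal (c * ∑' j, ρ (j + (q + 1)))) atTop (𝓝 0) := by
    simpa using! ENNReal.tendsto_ofReal
      (((tendsto_sum_nat_add ρ).comp (tendsto_add_atTop_nat 1)).const_mul c)
  refine ⟨k, hk, fun _ => hkt, tendsto_of_tendsto_of_tendsto_of_le_of_le' tendsto_const_nhds
    htail (Eventually.of_forall fun _ => zero_le) ?_⟩
  filter_upwards [eventually_ge_atTop p] with q hpq
  exact limsup_sum_measure_exceedance_inter_le hf hE hρ hs hdec hc hk hpq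

theorem IsExtremalIndex.tendsto_nat_mul_measureReal_exceedance {θ : ℝ}
    (hθ : IsExtremalIndex μ f ψ u θ) (hf : MeasurePreserving f μ μ)
    (hE : ∀ n, MeasurableSet (exceedance f ψ u 0 n))
    (hc : Tendsto (fun n : ℕ => (n : ℝ) * μ.real (exceedance f ψ u 0 n)) atTop (𝓝 c))
    (hret : Tendsto (fun n => firstReturn f (exceedance f ψ u p n)) atTop (𝓝 ⊤)) :
    Tendsto (fun n : ℕ => (n : ℝ) * μ.real (exceedance f ψ u p n)) atTop (𝓝 (θ * c)) := by
  obtain ⟨a, ha, haθ⟩ := hθ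
  have hlim : ∀ᶠ q in atTop, Tendsto (fun n : ℕ => (n : ℝ) * μ.real (exceedance f ψ u p n))
      atTop (𝓝 (a q * c)) := by
    filter_upwards [ha, eventually_ge_atTop p] with q hq hpq
    have h := (hq.mul hc).add (tendsto_nat_mul_measureReal_exceedance_sdiff hf hE hc hret q)
    rw [add_zero] at h
    refine h.congr fun n => ?_
    have hq0 : μ.real (exceedance f ψ u 0 n) = 0 → μ.real (exceedance f ψ u q n) = 0 := fun h0 =>
      measureReal_mono_null (exceedance_anti q.zero_le n) h0
    rw [mul_left_comm, div_mul_cancel_of_imp hq0,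
      measureReal_sdiff (exceedance_anti hpq n) (measurableSet_exceedance hf.measurable hE q n)]
    ring
  obtain ⟨q₀, hq₀⟩ := hlim.exists
  -- The left-hand side does not depend on `q`, so neither does `a q * c` for large `q`.
  have hconst : a q₀ * c = θ * c := tendsto_nhds_unique
    (tendsto_const_nhds.congr' (hlim.mono fun q hq => tendsto_nhds_unique hq₀ hq))
    (haθ.mul_const c)
  rwa [hconst] at hq₀

theorem abs_measureReal_maxLE_sub_noOccurrence_le (hf : MeasurePreserving f μ μ) {n : ℕ}
    (hE : MeasurableSet (exceedance f ψ u 0 n)) (p : ℕ) (hn : 1 ≤ n) :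
    |μ.real (maxLE f ψ u n) - μ.real (noOccurrence f 0 n (exceedance f ψ u p n))| ≤
      p * μ.real (exceedance f ψ u 0 n) := by
  rw [maxLE_eq_noOccurrence hn, exceedance_eq_escape p]
  set E := exceedance f ψ u 0 n
  have hsub := noOccurrence_anti (f := f) 0 n (escape_subset (f := f) E p)
  have hdiff : μ.real (noOccurrence f 0 n (escape f E p) \ noOccurrence f 0 n E) ≤
      p * μ.real E := by
    refine (measureReal_le_sum_of_subset_biUnion
      (noOccurrence_escape_sdiff_subset E p hn)).trans ?_
    simp only [measureReal_preimage_iterate hf hE, Finset.sum_const, Nat.card_Ico, nsmul_eq_mul]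
    gcongr
    omega
  rw [measureReal_sdiff hsub (measurableSet_noOccurrence hf.measurable hE 0 n)] at hdiff
  rwa [abs_sub_comm, abs_of_nonneg (sub_nonneg.2 (measureReal_mono hsub))]

theorem tendsto_measureReal_maxLE (hf : MeasurePreserving f μ μ)
    (hE : ∀ n, MeasurableSet (exceedance f ψ u 0 n))
    (hρ : ∀ n, 1 ≤ n → 0 ≤ ρ n) (hs : Summable ρ)
    (hdec : ∀ n, 1 ≤ n → IndicatorDecay μ f ρ (exceedance f ψ u p n))
    (hc : Tendsto (fun n : ℕ => (n : ℝ) * μ.real (exceedance f ψ u 0 n)) atTop (𝓝 c))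
    (hret : Tendsto (fun n => firstReturn f (exceedance f ψ u p n)) atTop (𝓝 ⊤))
    {θ : ℝ} (hθ : IsExtremalIndex μ f ψ u θ) :
    Tendsto (fun n => μ.real (maxLE f ψ u n)) atTop (𝓝 (Real.exp (-(θ * c)))) := by
  have hexp := tendsto_noOccurrence_exp hf (measurableSet_exceedance hf.measurable hE p) hρ hs hdec
    (hθ.tendsto_nat_mul_measureReal_exceedance hf hE hc hret) hret
  have hdiff : Tendsto (fun n => μ.real (maxLE f ψ u n) -
      μ.real (noOccurrence f 0 n (exceedance f ψ u p n))) atTop (𝓝 0) := by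
    refine squeeze_zero_norm' ?_
      (by simpa only [mul_zero] using (tendsto_zero_of_tendsto_nat_mul hc).const_mul (p : ℝ))
    filter_upwards [eventually_ge_atTop 1] with n hn
    exact abs_measureReal_maxLE_sub_noOccurrence_le hf (hE n) p hn
  simpa only [sub_add_cancel, zero_add] using hdiff.add hexp

end Exceedances

section Balls

/-- The measure of the ball of radius `r` at `ζ` is asymptotic to `L * r ^ m` as `r → 0`. This is
the only information on `μ` near the maximal sets that enters. The radii range over `ℝ≥0`. -/
structure HasBallDensity {X : Type*} [PseudoMetricSpace X] [MeasurableSpace X] (μ : Measure X)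
    (m L : ℝ) (ζ : X) : Prop where
  pos : 0 < L
  isEquivalent : (fun r : ℝ≥0 => μ.real (Metric.ball ζ r)) ~[𝓝 0] fun r => L * (r : ℝ) ^ m

theorem tendsto_ball_smallSets {X : Type*} [PseudoMetricSpace X] (ζ : X) :
    Tendsto (fun r : ℝ≥0 => Metric.ball ζ r) (𝓝 0) (𝓝 ζ).smallSets := by
  refine tendsto_smallSets_iff.2 fun t ht => ?_
  obtain ⟨ε, hε, hεt⟩ := Metric.mem_nhds_iff.1 ht
  filter_upwards [NNReal.continuous_coe.tendsto 0 |>.eventually_lt_const hε] with r hr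
  exact (Metric.ball_subset_ball hr.le).trans hεt

theorem volume_real_ball_unitInterval (ζ : I) (r : ℝ≥0) :
    (volume : Measure I).real (Metric.ball ζ r) = min ((ζ : ℝ) + r) 1 - max ((ζ : ℝ) - r) 0 := by
  have himage : Subtype.val '' Metric.ball ζ (r : ℝ) = Metric.ball (ζ : ℝ) r ∩ Icc 0 1 := by
    change Subtype.val '' (Subtype.val ⁻¹' Metric.ball (ζ : ℝ) r) = _
    rw [Subtype.image_preimage_coe, inter_comm]
  have hle : max ((ζ : ℝ) - r) 0 ≤ min ((ζ : ℝ) + r) 1 :=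
    max_le (le_min (by linarith [r.2]) (by linarith [r.2, ζ.2.2]))
      (le_min (by linarith [r.2, ζ.2.1]) zero_le_one)
  rw [measureReal_def, unitInterval.volume_apply, himage, Real.ball_eq_Ioo,
    measure_congr (Ioo_ae_eq_Icc.inter (ae_eq_refl (Icc (0 : ℝ) 1))), Icc_inter_Icc,
    ← measureReal_def, Real.volume_real_Icc_of_le hle]

theorem exists_hasBallDensity_volume (ζ : I) :
    ∃ w : ℝ, HasBallDensity (volume : Measure I) 1 w ζ := by
  have small : ∀ {a : ℝ}, 0 < a → ∀ᶠ r : ℝ≥0 in 𝓝 0, (r : ℝ) < a := fun ha =>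
    (NNReal.continuous_coe.tendsto 0).eventually_lt_const ha
  suffices h : ∃ w : ℝ, 0 < w ∧
      ∀ᶠ r : ℝ≥0 in 𝓝 0, min ((ζ : ℝ) + r) 1 - max ((ζ : ℝ) - r) 0 = w * r by
    obtain ⟨w, hw, hr⟩ := h
    refine ⟨w, hw, EventuallyEq.isEquivalent (hr.mono fun r hr => ?_)⟩
    simp only [volume_real_ball_unitInterval, hr, Real.rpow_one]
  rcases ζ.2.1.eq_or_lt with hζ0 | hζ0
  · refine ⟨1, one_pos, (small one_pos).mono fun r hr => ?_⟩
    rw [← hζ0, min_eq_left (by linarith), max_eq_right (by linarith [r.2])]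
    ring
  rcases ζ.2.2.eq_or_lt with hζ1 | hζ1
  · refine ⟨1, one_pos, (small one_pos).mono fun r hr => ?_⟩
    rw [hζ1, min_eq_right (by linarith [r.2]), max_eq_left (by linarith)]
    ring
  · refine ⟨2, two_pos, ?_⟩
    filter_upwards [small hζ0, small (sub_pos.2 hζ1)] with r hr0 hr1
    rw [min_eq_left (by linarith), max_eq_left (by linarith)]
    ring

theorem HasBallDensity.withDensity {X : Type*} [PseudoMetricSpace X] [MeasurableSpace X]
    [OpensMeasurableSpace X] {ν : Measure X} [IsLocallyFiniteMeasure ν] {m L : ℝ} {ζ : X}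
    (hν : HasBallDensity ν m L ζ) {h : X → ℝ≥0∞} (hh : Measurable h) (hcont : ContinuousAt h ζ)
    (h0 : h ζ ≠ 0) (htop : h ζ ≠ ∞) :
    HasBallDensity (ν.withDensity h) m (L * (h ζ).toReal) ζ := by
  have hpos : 0 < (h ζ).toReal := ENNReal.toReal_pos h0 htop
  have hcont' : ContinuousAt (fun x => (h x).toReal) ζ := (ENNReal.tendsto_toReal htop).comp hcont
  have hint : ∀ᶠ r : ℝ≥0 in 𝓝 0, ∫ x in Metric.ball ζ r, (h x).toReal ∂ν =
      (ν.withDensity h).real (Metric.ball ζ r) := by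
    filter_upwards [tendsto_smallSets_iff.1 (tendsto_ball_smallSets ζ) _
      (hcont.eventually_lt_const htop.lt_top)] with r hr
    have hball : MeasurableSet (Metric.ball ζ (r : ℝ)) := Metric.isOpen_ball.measurableSet
    rw [integral_toReal hh.aemeasurable ((ae_restrict_mem hball).mono hr), measureReal_def,
      withDensity_apply _ hball]
  have hequiv : (fun r : ℝ≥0 => (ν.withDensity h).real (Metric.ball ζ r)) ~[𝓝 0]
      fun r : ℝ≥0 => (h ζ).toReal * ν.real (Metric.ball ζ r) :=
    ((hcont'.integral_sub_linear_isLittleO_ae (μ := ν)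
      hh.ennreal_toReal.stronglyMeasurable.stronglyMeasurableAtFilter
      (tendsto_ball_smallSets ζ)).congr' (hint.mono fun r hr => by simp [hr, mul_comm])
      EventuallyEq.rfl).trans_isBigO (isBigO_self_const_mul hpos.ne' _ _)
  refine ⟨mul_pos hν.pos hpos,
    hequiv.trans ((IsEquivalent.refl.mul hν.isEquivalent).congr_right ?_)⟩
  exact Eventually.of_forall fun r => by simp only [Pi.mul_apply]; ring

theorem exists_hasBallDensity_withDensity_volume {h : I → ℝ≥0∞} (hh : Measurable h) {ζ : I}
    (hdens : ∃ U ∈ 𝓝 ζ, ContinuousOn h U ∧ ∀ x ∈ U, 0 < h x ∧ h x < ∞) :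
    ∃ L : ℝ, HasBallDensity ((volume : Measure I).withDensity h) 1 L ζ := by
  obtain ⟨U, hU, hcont, hpos⟩ := hdens
  obtain ⟨h0, htop⟩ := hpos ζ (mem_of_mem_nhds hU)
  obtain ⟨w, hw⟩ := exists_hasBallDensity_volume ζ
  exact ⟨_, hw.withDensity hh (hcont.continuousAt hU) h0.ne' htop.ne⟩

end Balls

section Radii

variable {m c : ℝ} {F : ℝ≥0 → ℝ} {r : ℕ → ℝ≥0} {s : ℝ}

theorem tendsto_zero_of_isEquivalent_rpow (hmono : Monotone F) (hc : 0 < c)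
    (hF : F ~[𝓝 0] fun r => c * (r : ℝ) ^ m)
    (hs : Tendsto (fun n : ℕ => (n : ℝ) * F (r n)) atTop (𝓝 s)) : Tendsto r atTop (𝓝 0) := by
  have hpos : ∀ ε : ℝ≥0, 0 < ε → 0 < F ε := fun ε hε => by
    have hev : ∀ᶠ r : ℝ≥0 in 𝓝[>] 0, 0 < F r :=
      (hF.mono nhdsWithin_le_nhds).eventually_pos <|
        eventually_mem_nhdsWithin.mono fun r hr => mul_pos hc (Real.rpow_pos_of_pos hr m)
    obtain ⟨r, hFr, hr⟩ := (hev.and (Ioo_mem_nhdsGT hε)).exists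
    exact hFr.trans_le (hmono hr.2.le)
  refine tendsto_order.2 ⟨fun a ha => absurd ha not_lt_zero, fun ε hε => ?_⟩
  filter_upwards [(tendsto_zero_of_tendsto_nat_mul hs).eventually_lt_const (hpos ε hε)] with n hn
  exact hmono.reflect_lt hn

theorem tendsto_nat_mul_iff_of_isEquivalent_rpow (hc : c ≠ 0)
    (hF : F ~[𝓝 0] fun r => c * (r : ℝ) ^ m) (hr : Tendsto r atTop (𝓝 0)) :
    Tendsto (fun n : ℕ => (n : ℝ) * F (r n)) atTop (𝓝 (c * s)) ↔
      Tendsto (fun n : ℕ => (n : ℝ) * (r n : ℝ) ^ m) atTop (𝓝 s) := by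
  have hequiv : (fun n : ℕ => (n : ℝ) * F (r n)) ~[atTop]
      fun n : ℕ => c * ((n : ℝ) * (r n : ℝ) ^ m) :=
    ((IsEquivalent.refl (u := fun n : ℕ => (n : ℝ))).mul (hF.comp_tendsto hr)).congr_right <|
      Eventually.of_forall fun n => mul_left_comm _ _ _
  rw [hequiv.tendsto_nhds_iff]
  exact tendsto_const_smul_iff₀ hc

theorem tendsto_zero_of_tendsto_nat_mul_rpow (hm : 0 ≤ m)
    (hs : Tendsto (fun n : ℕ => (n : ℝ) * (r n : ℝ) ^ m) atTop (𝓝 s)) : Tendsto r atTop (𝓝 0) :=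
  tendsto_zero_of_isEquivalent_rpow (F := fun r => (r : ℝ) ^ m) (m := m)
    (fun _ _ hab => Real.rpow_le_rpow (NNReal.coe_nonneg _) (NNReal.coe_le_coe.2 hab) hm) one_pos
    (by simpa only [one_mul] using IsEquivalent.refl) hs

theorem exists_pos_tendsto_nat_mul_rpow (hm : 0 < m) (hs : 0 ≤ s) :
    ∃ r : ℕ → ℝ≥0, (∀ n, 0 < r n) ∧
      Tendsto (fun n : ℕ => (n : ℝ) * (r n : ℝ) ^ m) atTop (𝓝 s) := by
  -- The summand `1 / (n + 1)` keeps the radii positive when `s = 0`.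
  have hv : ∀ n : ℕ, 0 < (s + 1 / ((n : ℝ) + 1)) / ((n : ℝ) + 1) := fun n =>
    div_pos (add_pos_of_nonneg_of_pos hs Nat.one_div_pos_of_nat) n.cast_add_one_pos
  refine ⟨fun n => ((s + 1 / ((n : ℝ) + 1)) / ((n : ℝ) + 1)).toNNReal ^ m⁻¹,
    fun n => NNReal.rpow_pos (Real.toNNReal_pos.2 (hv n)), ?_⟩
  have hprod := (tendsto_natCast_div_add_atTop (1 : ℝ)).mul
    (tendsto_one_div_add_atTop_nhds_zero_nat.const_add s)
  rw [one_mul, add_zero] at hprod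
  refine hprod.congr fun n => ?_
  rw [← NNReal.coe_rpow, NNReal.rpow_inv_rpow hm.ne', Real.coe_toNNReal _ (hv n).le]
  ring

end Radii

section Unions

variable {X : Type*} [MetricSpace X] [MeasurableSpace X] [OpensMeasurableSpace X]
  {μ : Measure X} [IsFiniteMeasure μ] {m s : ℝ} {L : X → ℝ} {S : Finset X}

theorem eventually_measureReal_biUnion_ball {κ : Type*} {l : Filter κ} {R : κ → X → ℝ≥0}
    (hR : ∀ ζ ∈ S, Tendsto (fun a => R a ζ) l (𝓝 0)) :
    ∀ᶠ a in l, μ.real (⋃ ζ ∈ S, Metric.ball ζ (R a ζ)) =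
      ∑ ζ ∈ S, μ.real (Metric.ball ζ (R a ζ)) := by
  obtain ⟨U, hU, hdisj⟩ := S.finite_toSet.t2_separation
  have hsub : ∀ᶠ a in l, ∀ ζ ∈ S, Metric.ball ζ (R a ζ : ℝ) ⊆ U ζ :=
    (eventually_all_finset S).2 fun ζ hζ =>
      tendsto_smallSets_iff.1 ((tendsto_ball_smallSets ζ).comp (hR ζ hζ)) _
        ((hU ζ).2.mem_nhds (hU ζ).1)
  filter_upwards [hsub] with a ha
  exact measureReal_biUnion_finset
    (fun x hx y hy hxy => (hdisj hx hy hxy).mono (ha x hx) (ha y hy))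
    fun _ _ => Metric.isOpen_ball.measurableSet

theorem isEquivalent_measureReal_thickening (hS : S.Nonempty)
    (hL : ∀ ζ ∈ S, HasBallDensity μ m (L ζ) ζ) :
    (fun r : ℝ≥0 => μ.real (Metric.thickening r (S : Set X))) ~[𝓝 0]
      fun r => (∑ ζ ∈ S, L ζ) * (r : ℝ) ^ m := by
  have hsum : (0 : ℝ) < ∑ ζ ∈ S, L ζ := Finset.sum_pos (fun ζ hζ => (hL ζ hζ).pos) hS
  refine IsLittleO.isEquivalent <| IsLittleO.trans_isBigO (IsLittleO.congr'
    (IsLittleO.sum fun ζ hζ => (hL ζ hζ).isEquivalent.isLittleO.trans_isBigO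
      (isBigO_const_mul_self (L ζ) (fun r : ℝ≥0 => (r : ℝ) ^ m) _)) ?_ EventuallyEq.rfl)
    (isBigO_self_const_mul hsum.ne' _ _)
  filter_upwards [eventually_measureReal_biUnion_ball (μ := μ) (S := S) (R := fun r _ => r)
    fun _ _ => tendsto_id] with r hr
  simp only [Metric.thickening_eq_biUnion_ball, Finset.mem_coe, Pi.sub_apply, hr,
    Finset.sum_apply, Finset.sum_sub_distrib, Finset.sum_mul]

theorem tendsto_nat_mul_measureReal_thickening_iff (hm : 0 ≤ m) (hS : S.Nonempty)
    (hL : ∀ ζ ∈ S, HasBallDensity μ m (L ζ) ζ) {r : ℕ → ℝ≥0} :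
    Tendsto (fun n : ℕ => (n : ℝ) * μ.real (Metric.thickening (r n) (S : Set X))) atTop
        (𝓝 ((∑ ζ ∈ S, L ζ) * s)) ↔
      Tendsto (fun n : ℕ => (n : ℝ) * (r n : ℝ) ^ m) atTop (𝓝 s) := by
  have hsum : (0 : ℝ) < ∑ ζ ∈ S, L ζ := Finset.sum_pos (fun ζ hζ => (hL ζ hζ).pos) hS
  have hmono : Monotone fun r : ℝ≥0 => μ.real (Metric.thickening r (S : Set X)) :=
    fun a b hab => measureReal_mono (Metric.thickening_mono (NNReal.coe_le_coe.2 hab) _)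
  have hequiv := isEquivalent_measureReal_thickening hS hL
  refine ⟨fun h => ?_, fun h => ?_⟩
  · exact (tendsto_nat_mul_iff_of_isEquivalent_rpow hsum.ne' hequiv
      (tendsto_zero_of_isEquivalent_rpow hmono hsum hequiv h)).1 h
  · exact (tendsto_nat_mul_iff_of_isEquivalent_rpow hsum.ne' hequiv
      (tendsto_zero_of_tendsto_nat_mul_rpow hm h)).2 h

theorem tendsto_nat_mul_measureReal_biUnion_ball (hm : 0 ≤ m)
    (hL : ∀ ζ ∈ S, HasBallDensity μ m (L ζ) ζ) {R : ℕ → X → ℝ≥0} {s : X → ℝ}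
    (hR : ∀ ζ ∈ S, Tendsto (fun n : ℕ => (n : ℝ) * (R n ζ : ℝ) ^ m) atTop (𝓝 (s ζ))) :
    Tendsto (fun n : ℕ => (n : ℝ) * μ.real (⋃ ζ ∈ S, Metric.ball ζ (R n ζ))) atTop
      (𝓝 (∑ ζ ∈ S, L ζ * s ζ)) := by
  have hR0 : ∀ ζ ∈ S, Tendsto (fun n => R n ζ) atTop (𝓝 0) := fun ζ hζ =>
    tendsto_zero_of_tendsto_nat_mul_rpow hm (hR ζ hζ)
  refine (tendsto_finsetSum S fun ζ hζ => (tendsto_nat_mul_iff_of_isEquivalent_rpow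
    (hL ζ hζ).pos.ne' (hL ζ hζ).isEquivalent (hR0 ζ hζ)).2 (hR ζ hζ)).congr' ?_
  filter_upwards [eventually_measureReal_biUnion_ball (μ := μ) hR0] with n hn
  rw [hn, Finset.mul_sum]

end Unions

section Observables

/-- The value of `g` at distance `r > 0`: the level that is exceeded exactly at distances less
than `r`. -/
noncomputable def ObservableType.level : ObservableType → ℝ → ℝ
  | .log, r => -Real.log r
  | .power α _, r => r ^ (-1 / α)
  | .bounded D α _, r => D - r ^ (1 / α)

theorem ObservableType.level_lt_g_iff (g : ObservableType) {r t : ℝ} (hr : 0 < r) (ht : 0 ≤ t) :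
    (g.level r : EReal) < g.g t ↔ t < r := by
  cases g with
  | log =>
    rcases ht.eq_or_lt' with rfl | ht
    · simp only [ObservableType.g, if_true, EReal.coe_lt_top, hr]
    · simp only [ObservableType.g, ObservableType.level, if_neg ht.ne', EReal.coe_lt_coe_iff,
        neg_lt_neg_iff]
      exact Real.log_lt_log_iff ht hr
  | power α hα =>
    rcases ht.eq_or_lt' with rfl | ht
    · simp only [ObservableType.g, if_true, EReal.coe_lt_top, hr]
    · simp only [ObservableType.g, ObservableType.level, if_neg ht.ne', EReal.coe_lt_coe_iff]
      exact Real.rpow_lt_rpow_iff_of_neg hr ht (div_neg_of_neg_of_pos (by norm_num) hα)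
  | bounded D α hα =>
    simp only [ObservableType.g, ObservableType.level, EReal.coe_lt_coe_iff, sub_lt_sub_iff_left]
    exact Real.rpow_lt_rpow_iff ht hr.le (one_div_pos.2 hα)

/-- Only `g t = t ^ (-1 / α)` with `u ≤ 0` falls under the second alternative. -/
theorem ObservableType.exists_radius (g : ObservableType) (u : ℝ) :
    (∃ r : ℝ≥0, ∀ t, 0 ≤ t → ((u : EReal) < g.g t ↔ t < r)) ∨ ∀ t, 0 ≤ t → (u : EReal) < g.g t := by
  have radius_of_level : ∀ r : ℝ, 0 < r → g.level r = u →
      ∃ r : ℝ≥0, ∀ t, 0 ≤ t → ((u : EReal) < g.g t ↔ t < r) :=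
    fun r hr h => ⟨⟨r, hr.le⟩, fun t ht => h ▸ g.level_lt_g_iff hr ht⟩
  cases g with
  | log =>
    exact .inl <| radius_of_level (Real.exp (-u)) (Real.exp_pos _) (by simp [ObservableType.level])
  | power α hα =>
    rcases le_or_gt u 0 with hu | hu
    · refine .inr fun t ht => ?_
      rcases ht.eq_or_lt' with rfl | ht
      · simp only [ObservableType.g, if_true, EReal.coe_lt_top]
      · simp only [ObservableType.g, if_neg ht.ne', EReal.coe_lt_coe_iff]
        exact hu.trans_lt (Real.rpow_pos_of_pos ht _)
    · refine .inl <| radius_of_level (u ^ (-α)) (Real.rpow_pos_of_pos hu _) ?_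
      rw [ObservableType.level, ← Real.rpow_mul hu.le, show -α * (-1 / α) = 1 by field_simp,
        Real.rpow_one]
  | bounded D α hα =>
    rcases le_or_gt D u with hu | hu
    · refine .inl ⟨0, fun t ht => iff_of_false ?_ (by simpa using ht)⟩
      simp only [ObservableType.g, EReal.coe_lt_coe_iff, not_lt]
      linarith [Real.rpow_nonneg ht (1 / α)]
    · refine .inl <| radius_of_level ((D - u) ^ α) (Real.rpow_pos_of_pos (sub_pos.2 hu) _) ?_
      rw [ObservableType.level, ← Real.rpow_mul (sub_pos.2 hu).le, mul_one_div_cancel hα.ne',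
        Real.rpow_one, sub_sub_cancel]

variable {X : Type*} {d : ℕ} {g : Fin d → ObservableType} {Z : Fin d → Finset X}

section Metric

variable [PseudoMetricSpace X]

theorem setOf_level_lt_observable {j : Fin d} (hZ : (Z j).Nonempty) {r : ℝ} (hr : 0 < r) :
    {x | ((g j).level r : EReal) < observable g Z j x} = Metric.thickening r (Z j : Set X) := by
  ext x
  rw [Metric.mem_thickening_iff_infDist_lt (Finset.coe_nonempty.2 hZ)]
  exact (g j).level_lt_g_iff hr Metric.infDist_nonneg

theorem setOf_lt_observable_eq_thickening_or_univ {j : Fin d} (hZ : (Z j).Nonempty) (u : ℝ) :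
    (∃ r : ℝ≥0, {x | (u : EReal) < observable g Z j x} = Metric.thickening r (Z j : Set X)) ∨
      {x | (u : EReal) < observable g Z j x} = univ := by
  rcases (g j).exists_radius u with ⟨r, hr⟩ | h
  · refine .inl ⟨r, ?_⟩
    ext x
    rw [Metric.mem_thickening_iff_infDist_lt (Finset.coe_nonempty.2 hZ)]
    exact hr _ Metric.infDist_nonneg
  · exact .inr <| eq_univ_of_forall fun x => h _ Metric.infDist_nonneg

theorem measurableSet_exceedance_observable_zero [MeasurableSpace X] [OpensMeasurableSpace X]
    {f : X → X} (hZ : ∀ j, (Z j).Nonempty) (u : ℕ → Fin d → ℝ) (n : ℕ) :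
    MeasurableSet (exceedance f (observable g Z) u 0 n) := by
  rw [exceedance_zero, ofPred_exists]
  refine MeasurableSet.iUnion fun j => ?_
  rcases setOf_lt_observable_eq_thickening_or_univ (g := g) (hZ j) (u n j) with ⟨r, hr⟩ | h
  · exact hr ▸ Metric.isOpen_thickening.measurableSet
  · exact h ▸ MeasurableSet.univ

theorem iUnion_thickening_eq_biUnion_ball [DecidableEq X] (r : Fin d → ℝ≥0) :
    ⋃ j, Metric.thickening (r j) (Z j : Set X) = ⋃ ζ ∈ Finset.univ.biUnion Z,
      Metric.ball ζ (({j | ζ ∈ Z j} : Finset (Fin d)).sup r : ℝ≥0) := by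
  ext x
  simp only [Metric.thickening_eq_biUnion_ball, mem_iUnion, Finset.mem_biUnion, Finset.mem_univ,
    true_and, Metric.mem_ball, exists_prop, ← coe_nndist, NNReal.coe_lt_coe, Finset.lt_sup_iff,
    Finset.mem_filter, Finset.mem_coe]
  exact ⟨fun ⟨j, ζ, hζ, h⟩ => ⟨ζ, ⟨j, hζ⟩, j, hζ, h⟩, fun ⟨ζ, _, j, hζ, h⟩ => ⟨j, ζ, hζ, h⟩⟩

end Metric

theorem IsNormalising.exists_radius [PseudoMetricSpace X] [MeasurableSpace X] {μ : Measure X}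
    [IsProbabilityMeasure μ] {τ : Fin d → ℝ} {u : ℕ → Fin d → ℝ}
    (hu : IsNormalising μ (observable g Z) τ u) (hZ : ∀ j, (Z j).Nonempty) :
    ∃ r : ℕ → Fin d → ℝ≥0, ∀ᶠ n in atTop, ∀ j,
      {x | (u n j : EReal) < observable g Z j x} = Metric.thickening (r n j) (Z j : Set X) := by
  have hradius : ∀ n j, ∃ r : ℝ≥0, {x | (u n j : EReal) < observable g Z j x} ≠ univ →
      {x | (u n j : EReal) < observable g Z j x} = Metric.thickening r (Z j : Set X) := fun n j =>
    (setOf_lt_observable_eq_thickening_or_univ (hZ j) (u n j)).elim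
      (fun ⟨r, hr⟩ => ⟨r, fun _ => hr⟩) fun h => ⟨0, fun hne => absurd h hne⟩
  choose r hr using hradius
  refine ⟨r, eventually_all.2 fun j => ?_⟩
  filter_upwards [(tendsto_zero_of_tendsto_nat_mul (hu j)).eventually_lt_const one_pos] with n hn
  refine hr n j fun huniv => hn.ne ?_
  rw [huniv, probReal_univ]

/-- The limit of `n μ(X_0 ≰ u_n(τ))`, called `Γ̂(τ)` in the theorem, when `L ζ` is the density of
the measure of small balls at `ζ`. A point that belongs to several of the sets `Z j` contributes
with the largest of the corresponding radii. -/
noncomputable def exceedanceRate [DecidableEq X] (Z : Fin d → Finset X) (L : X → ℝ)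
    (τ : Fin d → ℝ) : ℝ :=
  ∑ ζ ∈ Finset.univ.biUnion Z, L ζ * (({j | ζ ∈ Z j} : Finset (Fin d)).sup fun j =>
    (τ j / ∑ ξ ∈ Z j, L ξ).toNNReal : ℝ≥0)

variable [MetricSpace X] [MeasurableSpace X] [OpensMeasurableSpace X] {μ : Measure X} {m : ℝ}
  {L : X → ℝ} {τ : Fin d → ℝ}

theorem exists_isNormalising [IsFiniteMeasure μ] (hm : 0 < m) (hZ : ∀ j, (Z j).Nonempty)
    (hL : ∀ j, ∀ ζ ∈ Z j, HasBallDensity μ m (L ζ) ζ) (hτ : 0 ≤ τ) :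
    ∃ u : ℕ → Fin d → ℝ, IsNormalising μ (observable g Z) τ u := by
  have hsum : ∀ j, 0 < ∑ ζ ∈ Z j, L ζ := fun j =>
    Finset.sum_pos (fun ζ hζ => (hL j ζ hζ).pos) (hZ j)
  choose r hpos hr using fun j =>
    exists_pos_tendsto_nat_mul_rpow hm (div_nonneg (hτ j) (hsum j).le)
  refine ⟨fun n j => (g j).level (r j n), fun j => ?_⟩
  have hthick := (tendsto_nat_mul_measureReal_thickening_iff hm.le (hZ j) (hL j)).2 (hr j)
  rw [mul_div_cancel₀ _ (hsum j).ne'] at hthick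
  exact hthick.congr fun n => by
    rw [setOf_level_lt_observable (hZ j) (NNReal.coe_pos.2 (hpos j n))]

theorem IsNormalising.tendsto_nat_mul_radius_rpow [IsFiniteMeasure μ] (hm : 0 ≤ m)
    (hZ : ∀ j, (Z j).Nonempty) (hL : ∀ j, ∀ ζ ∈ Z j, HasBallDensity μ m (L ζ) ζ)
    {u : ℕ → Fin d → ℝ} (hu : IsNormalising μ (observable g Z) τ u) {r : ℕ → Fin d → ℝ≥0}
    (hr : ∀ᶠ n in atTop, ∀ j,
      {x | (u n j : EReal) < observable g Z j x} = Metric.thickening (r n j) (Z j : Set X))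
    (j : Fin d) :
    Tendsto (fun n : ℕ => (n : ℝ) * (r n j : ℝ) ^ m) atTop (𝓝 (τ j / ∑ ζ ∈ Z j, L ζ)) := by
  have hsum : 0 < ∑ ζ ∈ Z j, L ζ := Finset.sum_pos (fun ζ hζ => (hL j ζ hζ).pos) (hZ j)
  rw [← tendsto_nat_mul_measureReal_thickening_iff hm (hZ j) (hL j), mul_div_cancel₀ _ hsum.ne']
  exact (hu j).congr' (hr.mono fun n hn => by rw [hn j])

theorem tendsto_nat_mul_sup_rpow {κ : Type*} (T : Finset κ) {r : ℕ → κ → ℝ≥0} {s : κ → ℝ}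
    (hm : 0 < m)
    (hr : ∀ j ∈ T, Tendsto (fun n : ℕ => (n : ℝ) * (r n j : ℝ) ^ m) atTop (𝓝 (s j))) :
    Tendsto (fun n : ℕ => (n : ℝ) * ((T.sup (r n) : ℝ≥0) : ℝ) ^ m) atTop
      (𝓝 (T.sup fun j => (s j).toNNReal : ℝ≥0)) := by
  have hsup : Tendsto (fun n : ℕ => T.sup fun j => (n : ℝ≥0) * r n j ^ m) atTop
      (𝓝 (T.sup fun j => (s j).toNNReal)) :=
    Tendsto.finset_sup_nhds_apply fun j hj =>
      (tendsto_real_toNNReal (hr j hj)).congr fun n => by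
        rw [← Real.toNNReal_coe (r := n * r n j ^ m)]; push_cast; rfl
  refine (NNReal.tendsto_coe.2 hsup).congr fun n => ?_
  have hrpow : T.sup (r n) ^ m = T.sup fun j => r n j ^ m :=
    map_finset_sup (NNReal.orderIsoRpow m hm) T (r n)
  rw [← NNReal.mul_finset_sup, ← hrpow]
  push_cast
  rfl

theorem IsNormalising.tendsto_nat_mul_exceedance_zero [IsProbabilityMeasure μ] [DecidableEq X]
    {f : X → X} (hm : 0 < m) (hZ : ∀ j, (Z j).Nonempty)
    (hL : ∀ j, ∀ ζ ∈ Z j, HasBallDensity μ m (L ζ) ζ) {u : ℕ → Fin d → ℝ}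
    (hu : IsNormalising μ (observable g Z) τ u) :
    Tendsto (fun n : ℕ => (n : ℝ) * μ.real (exceedance f (observable g Z) u 0 n)) atTop
      (𝓝 (exceedanceRate Z L τ)) := by
  obtain ⟨r, hr⟩ := hu.exists_radius hZ
  have hunion := tendsto_nat_mul_measureReal_biUnion_ball (S := Finset.univ.biUnion Z) hm.le
    (fun ζ hζ => (Finset.mem_biUnion.1 hζ).elim fun j hj => hL j ζ hj.2)
    fun ζ _ => tendsto_nat_mul_sup_rpow ({j | ζ ∈ Z j} : Finset (Fin d)) hm fun j _ =>
      hu.tendsto_nat_mul_radius_rpow hm.le hZ hL hr j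
  refine hunion.congr' ?_
  filter_upwards [hr] with n hn
  rw [exceedance_zero, ofPred_exists, iUnion_congr hn, iUnion_thickening_eq_biUnion_ball]

end Observables

end MultivariateExtremes

open MultivariateExtremes in
theorem mainTheorem2_general {X : Type*} [MetricSpace X] [DecidableEq X] [MeasurableSpace X]
    [OpensMeasurableSpace X] {f : X → X} {μ : Measure X} [IsProbabilityMeasure μ]
    (hf : MeasurePreserving f μ μ) {C : Type*} [NormedAddCommGroup C] [NormedSpace ℝ C]
    {ι : C →ₗ[ℝ] Lp ℝ 1 μ} (hdecay : SummableDecay μ f ι) {d : ℕ} {Z : Fin d → Finset X}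
    (hZ : ∀ j, (Z j).Nonempty) {m : ℝ} (hm : 0 < m) {L : X → ℝ}
    (hL : ∀ j, ∀ ζ ∈ Z j, HasBallDensity μ m (L ζ) ζ) (g : Fin d → ObservableType)
    {τ : Fin d → ℝ} (hτ : 0 ≤ τ) :
    (∃ u : ℕ → Fin d → ℝ, IsNormalising μ (observable g Z) τ u) ∧
    ∀ u : ℕ → Fin d → ℝ, IsNormalising μ (observable g Z) τ u →
      Tendsto (fun n : ℕ => (n : ℝ) * μ.real (exceedance f (observable g Z) u 0 n)) atTop
        (𝓝 (exceedanceRate Z L τ)) ∧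
      ∀ θ : ℝ, IsExtremalIndex μ f (observable g Z) u θ →
      ∀ p : ℕ,
        Tendsto (fun n => firstReturn f (exceedance f (observable g Z) u p n)) atTop (𝓝 ⊤) →
        BoundedIndicators μ ι (fun n => exceedance f (observable g Z) u p n) →
        (∃ t : ℕ → ℕ → ℕ, MixingCondition μ f (observable g Z) u t ∧
          ClusterSeparation μ f (observable g Z) u t) ∧
        Tendsto (fun n => μ.real (maxLE f (observable g Z) u n)) atTop
          (𝓝 (Real.exp (-(θ * exceedanceRate Z L τ)))) := by
  refine ⟨exists_isNormalising hm hZ hL hτ, fun u hu => ?_⟩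
  have hc := hu.tendsto_nat_mul_exceedance_zero (f := f) hm hZ hL
  have hE := measurableSet_exceedance_observable_zero (f := f) (g := g) hZ u
  have hEp := measurableSet_exceedance hf.measurable hE
  refine ⟨hc, fun θ hθ p hret hbdd => ?_⟩
  obtain ⟨ρ, hρ, hs, hdec⟩ := hdecay.exists_indicatorDecay hf (hEp p) hbdd
  obtain ⟨t, k, ht1, hk, hkt, hmix⟩ := exists_gaps_tendsto_nat_mul_mixingCoeff hf hρ hs hdec
  exact ⟨⟨fun _ => t, mixingCondition_of_tendsto_mixingCoeff hf hE hc hret ht1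
      (tendsto_div_of_tendsto_mul_div hk hkt) hmix,
    clusterSeparation_of_indicatorDecay hf.measurable hE hρ hs hdec hc hk hkt⟩,
    tendsto_measureReal_maxLE hf hE hρ hs hdec hc hret hθ⟩

theorem mainTheorem2
    (f : I → I) (μ : Measure I) [IsProbabilityMeasure μ] (hf : MeasurePreserving f μ μ)
    (h : I → ℝ≥0∞) (hh : Measurable h) (hμ : μ = (volume : Measure I).withDensity h)
    (C : Type*) [NormedAddCommGroup C] [NormedSpace ℝ C] [CompleteSpace C]
    (ι : C →ₗ[ℝ] Lp ℝ 1 μ) (hdecay : MultivariateExtremes.SummableDecay μ f ι)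
    (d : ℕ) (Z : Fin d → Finset I) (hZ : ∀ j, (Z j).Nonempty)
    (hfcont : ∀ j, ∀ ζ ∈ Z j, ∃ U ∈ 𝓝 ζ, ContinuousOn f U)
    (hdens : ∀ j, ∀ ζ ∈ Z j, ∃ U ∈ 𝓝 ζ, ContinuousOn h U ∧ ∀ x ∈ U, 0 < h x ∧ h x < ∞)
    (g : Fin d → MultivariateExtremes.ObservableType)
    (ψ : Fin d → I → EReal) (hψ : ψ = MultivariateExtremes.observable g Z) :
    ∃ Γhat : (Fin d → ℝ) → ℝ, ∀ τ : Fin d → ℝ, 0 ≤ τ → τ ≠ 0 →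
      (∃ u : ℕ → Fin d → ℝ, MultivariateExtremes.IsNormalising μ ψ τ u) ∧
      ∀ u : ℕ → Fin d → ℝ, MultivariateExtremes.IsNormalising μ ψ τ u →
        Tendsto (fun n : ℕ => (n : ℝ) * μ.real (MultivariateExtremes.exceedance f ψ u 0 n))
          atTop (𝓝 (Γhat τ)) ∧
        ∀ θ : ℝ, MultivariateExtremes.IsExtremalIndex μ f ψ u θ →
        ∀ p : ℕ,
          IsLeast {j : ℕ | Tendsto (fun n => MultivariateExtremes.firstReturn f
            (MultivariateExtremes.exceedance f ψ u j n)) atTop (𝓝 ⊤)} p →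
          MultivariateExtremes.BoundedIndicators μ ι
            (fun n => MultivariateExtremes.exceedance f ψ u p n) →
          (∃ t : ℕ → ℕ → ℕ, MultivariateExtremes.MixingCondition μ f ψ u t ∧
            MultivariateExtremes.ClusterSeparation μ f ψ u t) ∧
          Tendsto (fun n => μ.real (MultivariateExtremes.maxLE f ψ u n)) atTop
            (𝓝 (Real.exp (-(θ * Γhat τ)))) := by
  open MultivariateExtremes in
  subst hμ hψ
  have hball : ∀ ζ, (∃ j, ζ ∈ Z j) → ∃ L, HasBallDensity (volume.withDensity h) 1 L ζ :=
    fun ζ ⟨j, hj⟩ => exists_hasBallDensity_withDensity_volume hh (hdens j ζ hj)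
  choose! L hL using hball
  refine ⟨exceedanceRate Z L, fun τ hτ _ => ?_⟩
  obtain ⟨hex, hall⟩ :=
    mainTheorem2_general hf hdecay hZ one_pos (fun j ζ hζ => hL ζ ⟨j, hζ⟩) g hτ
  exact ⟨hex, fun u hu => ⟨(hall u hu).1, fun θ hθ p hp => (hall u hu).2 θ hθ p hp.1⟩⟩
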